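/- Let $q$ be the density of a proposal distribution $Q_Y$ on $\mathcal Y$, let $P_{Y|X}(\cdot|x)$ be a conditional density (the encoder's target) and $\tilde P_{Y|Z}(\cdot|z)$ an arbitrary conditional density (the decoder's target), all with respect to a common reference measure. Assume there are $\omega_x,\omega_z$ and a constant $\omega$ with $P_{Y|X}(y|x)\le\omega_x q(y)$, $\tilde P_{Y|Z}(y|z)\le\omega_z q(y)$ and $\omega_x,\omega_z\le\omega<\infty$ for all $x,y,z$ (for instance $\omega_x=\max_y P_{Y|X}(y|x)/q(y)$ and $\omega_z=\max_y \tilde P_{Y|Z}(y|z)/q(y)$). Fix a batch size $N\ge 2$, and let the shared randomness be $W=\{(B_i,U_i)\}_{i\ge1}$, $B_i=\{(Y_{ij},S_{ij})\}_{j=1}^N$, with all variables independent, $Y_{ij}\sim Q_Y$, $S_{ij}\sim\mathrm{Exp}(1)$, $U_i\sim\mathrm{Unif}(0,1)$. For a target density $p$ with $p\le c\,q$, Ensemble Rejection Sampling (ERS) with bound $c$ puts $\lambda_{ij}=p(Y_{ij})/q(Y_{ij})$ and $k_i=\arg\min_{j} S_{ij}/\lambda_{ij}$, accepts batch $i$ if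 $U_i\le \hat Z_i/(\hat Z_i+c-\lambda_{i k_i})$, where $\hat Z_i=\sum_{j=1}^N\lambda_{ij}$, and outputs $Y_{i k_i}$ for the first accepted batch $i$. Let $X$ be independent of $W$. Given $X=x$, the encoder outputs $Y_A$, the result of ERS on $W$ with target $P^A_Y=P_{Y|X}(\cdot|x)$ and bound $\omega_x$. Then $Z\sim P_{Z|X,Y}(\cdot|x,y)$ is generated from $X=x$, $Y_A=y$, so that $Z-(X,Y_A)-W$ is a Markov chain. Given $Z=z$, the decoder outputs $Y_B$, the result of ERS on the same $W$ with target $P^B_Y=\tilde P_{Y|Z}(\cdot|z)$ and bound $\omega_z$. Put $d_2(Q\|P)=\mathbb E_{Y\sim Q}[q(Y)/p(Y)]\in[0,\infty]$ for a distribution $P$ with density $p$, let $\mathbb I_N(\omega,2)=2\cdot\mathbf 1_{N>2}+\omega\cdot\mathbf 1_{N=2}$, and $$\mu_1'(N)=\frac1N\Big[\omega+\omega\,\mathbb I_N(\omega,2)\,d_2(Q_Y\|P^B_Y)+\frac{\omega^2}{N-1}d_2(Q_Y\|P^B_Y)\Big],$$ $$\mu_2'(N)=\frac1N\Big[\omega+\omega\,\mathbb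 I_N(\omega,2)\,d_2(Q_Y\|P^A_Y)+\frac{\omega^2}{N-1}d_2(Q_Y\|P^A_Y)\Big].$$ Then, for almost every $(y,x,z)$ with respect to the law of $(Y_A,X,Z)$, $$\Pr(Y_A=Y_B\mid Y_A=y,X=x,Z=z)\ \ge\ \Big(1+\mu_1'(N)+\frac{P^A_Y(y)}{P^B_Y(y)}\big(1+\mu_2'(N)\big)\Big)^{-1},$$ where the right-hand side is $0$ if the bracket is infinite. Moreover, for every $z$ with $d_2(Q_Y\|P^B_Y)<\infty$, $\mu_1'(N)\to0$ as $N\to\infty$ with $\mu_1'(N)=\Theta(1/N)$; and for every $x$ with $d_2(Q_Y\|P^A_Y)<\infty$, $\mu_2'(N)\to0$ with $\mu_2'(N)=\Theta(1/N)$. -/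

import Mathlib

open MeasureTheory ProbabilityTheory Filter Asymptotics
open scoped ENNReal NNReal Topology

noncomputable section

namespace ERS

/-- A probability density on `𝒴` with respect to the reference measure `ν`. -/
structure IsDensity {𝒴 : Type*} [MeasurableSpace 𝒴] (ν : Measure 𝒴) (q : 𝒴 → ℝ≥0) : Prop where
  measurable : Measurable q
  lintegral_eq_one : ∫⁻ y, (q y : ℝ≥0∞) ∂ν = 1

/-- A conditional probability density `p(y|a)`, written `p a y`, with respect to `ν`. -/
structure IsCondDensity {α 𝒴 : Type*} [MeasurableSpace α] [MeasurableSpace 𝒴]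
    (ν : Measure 𝒴) (p : α → 𝒴 → ℝ≥0) : Prop where
  measurable : Measurable (Function.uncurry p)
  lintegral_eq_one : ∀ a, ∫⁻ y, (p a y : ℝ≥0∞) ∂ν = 1

/-- The probability measure `Q` with density `q` with respect to `ν`. -/
def distOf {𝒴 : Type*} [MeasurableSpace 𝒴] (ν : Measure 𝒴) (q : 𝒴 → ℝ≥0) : Measure 𝒴 :=
  ν.withDensity fun y => (q y : ℝ≥0∞)

/-- The ratio of densities `p(y)/q(y)`, with values in `[0, ∞]` (`c/0 = ∞` for `c > 0`). -/
def ratio {𝒴 : Type*} (p q : 𝒴 → ℝ≥0) (y : 𝒴) : ℝ≥0∞ := (p y : ℝ≥0∞) / (q y : ℝ≥0∞)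

/-- A realization of the shared randomness `W`: a sequence of pairs `(B i, U i)`, where the batch
`B i` consists of `N` pairs `(Y i j, S i j)`. -/
abbrev Randomness (N : ℕ) (𝒴 : Type*) : Type _ := ℕ → (Fin N → 𝒴 × ℝ) × ℝ

/-- The law of the shared randomness: all coordinates are independent, `Y i j ∼ Q`,
`S i j ∼ Exp(1)` and `U i ∼ Unif(0,1)`. -/
def randomnessLaw {𝒴 : Type*} [MeasurableSpace 𝒴] (N : ℕ) (Q : Measure 𝒴) :
    Measure (Randomness N 𝒴) :=
  Measure.infinitePi fun _ : ℕ =>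
    (Measure.pi fun _ : Fin N => Q.prod (expMeasure 1)).prod
      ((volume : Measure ℝ).restrict (Set.Ioo 0 1))

theorem argminSet_nonempty {N : ℕ} [NeZero N] (r : Fin N → ℝ≥0∞) :
    (Finset.univ.filter fun k => ∀ j, r k ≤ r j).Nonempty := by
  obtain ⟨k, hk⟩ := Finite.exists_min r
  exact ⟨k, by simpa using hk⟩

/-- `argmin_k r k`, ties being broken in favour of the smallest index. -/
def argminIdx {N : ℕ} [NeZero N] (r : Fin N → ℝ≥0∞) : Fin N :=
  (Finset.univ.filter fun k => ∀ j, r k ≤ r j).min' (argminSet_nonempty r)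

section Algorithm

variable {N : ℕ} {𝒴 : Type*} (p q : 𝒴 → ℝ≥0)

/-- The candidate `argmin_k S k / λ k`, `λ k = p(Y k)/q(Y k)`, of a batch (`S k / 0 = ∞` for
`S k > 0`, so that proposals of weight zero are not chosen before others). -/
def candidate [NeZero N] (b : Fin N → 𝒴 × ℝ) : Fin N :=
  argminIdx fun k => ENNReal.ofReal (b k).2 / ratio p q (b k).1

/-- `Ẑ = ∑ k, λ k`. -/
def zHat (b : Fin N → 𝒴 × ℝ) : ℝ≥0∞ := ∑ k, ratio p q (b k).1

/-- `Z̄ = Ẑ + c - λ k`, where `c` is the bound on `p/q` that the algorithm uses. -/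
def zBar (c : ℝ≥0) (b : Fin N → 𝒴 × ℝ) (k : Fin N) : ℝ≥0∞ :=
  zHat p q b + c - ratio p q (b k).1

/-- The pair (batch, uniform variable) is accepted: `U ≤ Ẑ / Z̄`. -/
def Accepts [NeZero N] (c : ℝ≥0) (a : (Fin N → 𝒴 × ℝ) × ℝ) : Prop :=
  ENNReal.ofReal a.2 ≤ zHat p q a.1 / zBar p q c a.1 (candidate p q a.1)

/-- `K₁`: the first accepted batch (one exists almost surely; batches are numbered from `0`). -/
def batchIndex [NeZero N] (c : ℝ≥0) (w : Randomness N 𝒴) : ℕ :=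
  sInf {i | Accepts p q c (w i)}

/-- `K₂`: the index of the selected proposal within the first accepted batch. -/
def localIndex [NeZero N] (c : ℝ≥0) (w : Randomness N 𝒴) : Fin N :=
  candidate p q (w (batchIndex p q c w)).1

/-- The output `Y_K`, `K = (K₁, K₂)`, of Ensemble Rejection Sampling run on the shared randomness
`w`, with target density `p`, proposal density `q` and ratio bound `c`. -/
def output [NeZero N] (c : ℝ≥0) (w : Randomness N 𝒴) : 𝒴 :=
  ((w (batchIndex p q c w)).1 (localIndex p q c w)).1

end Algorithm

/-- `d₂(Q‖P) = 𝔼_{Y ∼ Q} [q(Y)/p(Y)]`, with values in `[0, ∞]` (`q/p = ∞` where `p = 0 < q`). -/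
def d2 {𝒴 : Type*} [MeasurableSpace 𝒴] (ν : Measure 𝒴) (q p : 𝒴 → ℝ≥0) : ℝ≥0∞ :=
  ∫⁻ y, ratio q p y ∂(distOf ν q)

/-- `𝕀_N(ω, i) = 2·1[N > i] + ω·1[N = i]`. -/
def ind (N i : ℕ) (ω : ℝ≥0) : ℝ≥0∞ :=
  2 * (if i < N then 1 else 0) + ω * (if N = i then 1 else 0)

/-- The coefficient `(1/N) [ω + ω 𝕀_N(ω, 2) d + (ω² / (N - 1)) d]`, used for `N ≥ 2`. -/
def coeff (ω : ℝ≥0) (d : ℝ≥0∞) (N : ℕ) : ℝ≥0∞ :=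
  (1 / (N : ℝ≥0∞)) * (ω + ω * ind N 2 ω * d + (ω : ℝ≥0∞) ^ 2 / ((N : ℝ≥0∞) - 1) * d)

/-- The lower bound `(1 + μ₁ + (p^A(y)/p^B(y)) (1 + μ₂))⁻¹`, which is `0` when the bracket
is infinite. -/
def matchBound {𝒴 : Type*} (pA pB : 𝒴 → ℝ≥0) (μ₁ μ₂ : ℝ≥0∞) (y : 𝒴) : ℝ≥0∞ :=
  (1 + μ₁ + ratio pA pB y * (1 + μ₂))⁻¹

end ERS

end

/-!
Both parties run on the same batches, so the outputs agree as soon as the first batch is accepted by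
both and both pick the same candidate in it; the later batches are not needed for the lower bound.

Fix `x` and `z`, split off proposal `j` of the first batch, and condition on its value `y`, of
weights `a = p^A(y)/q(y)` and `b = p^B(y)/q(y)`. Let `aₗ`, `bₗ` be the weights of the other
`N - 1` proposals and `s`, `t` their sums. Proposal `j` is the candidate of both parties when its
exponential clock wins a race against clocks of relative rates `max (aₗ/a) (bₗ/b)`, which has
probability `1 / (1 + ∑ max (aₗ/a) (bₗ/b))`, and given the proposals, both parties accept with the
smaller of the two acceptance probabilities. Since the maximum is at most the sum, the product is
at least `1 / matchCost`, where `matchCost` consists of `(s + c_A)/a + (t + c_B)/b` and cross terms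
proportional to `t / (a + s)` and `s / (b + t)` (`inv_matchCost_le`). By Jensen's inequality the
expectation is at least `1 / 𝔼[matchCost]`. The expected cross terms are controlled by `d₂`: each
summand of the numerator is decoupled from the denominator by dropping one term there, and the
harmonic-arithmetic mean inequality bounds the expected inverse sum
(`lintegral_pi_sum_div_sum_le`). The result is `le_othersLaw_of_matchBound`.

On the other side, the output of the encoder has a law of density at most `p^A` (`map_output_le`):
a batch is accepted with a candidate in `E` with probability proportional to `P^A(E)`, and the
first accepted batch is found by a geometric trial. Integrating the pointwise bound against this
law, the law of `X` and the kernel of `Z` shows that, over every event in `(Y_A, X, Z)`, the bound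
integrates to at most the probability of a match (`lintegral_matchBound_le`), which is the claim on
the conditional probability. The proposal splitting takes the place of a regular conditional
distribution of `W` given `Y_A`, which need not exist as `𝒴` is a general measurable space.
-/

noncomputable section

namespace ERS

/-! ### Measurability of the algorithm -/

theorem argminIdx_le {N : ℕ} [NeZero N] (r : Fin N → ℝ≥0∞) (j : Fin N) :
    r (argminIdx r) ≤ r j := by
  have h := Finset.min'_mem _ (argminSet_nonempty r)
  simp only [Finset.mem_filter, Finset.mem_univ, true_and] at h
  exact h j

theorem argminIdx_eq_iff {N : ℕ} [NeZero N] (r : Fin N → ℝ≥0∞) (k : Fin N) :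
    argminIdx r = k ↔ (∀ j, r k ≤ r j) ∧ ∀ i, i < k → ¬ ∀ j, r i ≤ r j := by
  constructor
  · rintro rfl
    refine ⟨argminIdx_le r, fun i hi h => ?_⟩
    exact absurd (Finset.min'_le _ i (by simpa using h)) (not_le.2 hi)
  · rintro ⟨h1, h2⟩
    refine le_antisymm (Finset.min'_le _ k (by simpa using h1)) ?_
    by_contra! hlt
    exact h2 _ hlt (argminIdx_le r)

theorem argminIdx_eq_of_lt {N : ℕ} [NeZero N] (r : Fin N → ℝ≥0∞) (k : Fin N)
    (h : ∀ j, j ≠ k → r k < r j) : argminIdx r = k := by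
  by_contra hne
  exact absurd (argminIdx_le r k) (not_le.2 (h _ hne))

section Measurability

variable {α β 𝒴 : Type*} [MeasurableSpace α] [MeasurableSpace β] [MeasurableSpace 𝒴]

theorem measurable_argminIdx {N : ℕ} [NeZero N] {r : β → Fin N → ℝ≥0∞}
    (hr : ∀ k, Measurable fun b => r b k) : Measurable fun b => argminIdx (r b) := by
  refine measurable_to_countable' fun k => ?_
  have hm : ∀ i, MeasurableSet {b | ∀ j, r b i ≤ r b j} := fun i => by
    rw [Set.ofPred_forall]
    exact MeasurableSet.iInter fun j => measurableSet_le (hr i) (hr j)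
  have : (fun b => argminIdx (r b)) ⁻¹' {k} =
      {b | ∀ j, r b k ≤ r b j} ∩ ⋂ i, ⋂ (_ : i < k), {b | ∀ j, r b i ≤ r b j}ᶜ := by
    ext b
    simp only [Set.mem_preimage, Set.mem_singleton_iff, argminIdx_eq_iff, Set.mem_inter_iff,
      Set.mem_ofPred_eq, Set.mem_iInter, Set.mem_compl_iff]
  rw [this]
  exact (hm k).inter (MeasurableSet.iInter fun i => MeasurableSet.iInter fun _ => (hm i).compl)

/-- The first hitting index `sInf {i | b ∈ s i}` is measurable; it is `0` when no `s i`
contains `b`. -/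
theorem measurable_sInf_setOf_mem {s : ℕ → Set β} (hs : ∀ i, MeasurableSet (s i)) :
    Measurable fun b => sInf {i | b ∈ s i} := by
  refine measurable_to_countable' fun n => ?_
  have : (fun b => sInf {i | b ∈ s i}) ⁻¹' {n} =
      (s n ∩ ⋂ m, ⋂ (_ : m < n), (s m)ᶜ) ∪ ({_b | n = 0} ∩ ⋂ m, (s m)ᶜ) := by
    ext b
    simp only [Set.mem_preimage, Set.mem_singleton_iff, Set.mem_union, Set.mem_inter_iff,
      Set.mem_iInter, Set.mem_compl_iff, Set.mem_ofPred_eq]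
    constructor
    · intro h
      rcases Set.eq_empty_or_nonempty {i | b ∈ s i} with he | he
      · right
        refine ⟨by rw [← h, he, Nat.sInf_empty], fun m hm => ?_⟩
        exact (Set.eq_empty_iff_forall_notMem.1 he) m hm
      · left
        exact ⟨h ▸ Nat.sInf_mem he, fun m hm => Nat.notMem_of_lt_sInf (h ▸ hm)⟩
    · rintro (⟨h1, h2⟩ | ⟨rfl, h⟩)
      · refine le_antisymm (Nat.sInf_le h1) ?_
        by_contra! hlt
        exact h2 _ hlt (Nat.sInf_mem (s := {i | b ∈ s i}) ⟨n, h1⟩)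
      · rw [show {i | b ∈ s i} = ∅ from Set.eq_empty_iff_forall_notMem.2 h, Nat.sInf_empty]
  rw [this]
  exact ((hs n).inter (MeasurableSet.iInter fun m => MeasurableSet.iInter fun _ =>
    (hs m).compl)).union ((MeasurableSet.const _).inter (MeasurableSet.iInter fun m =>
      (hs m).compl))

theorem measurable_apply_of_countable {ι : Type*} [Countable ι] [MeasurableSpace ι]
    [MeasurableSingletonClass ι] {γ : Type*} [MeasurableSpace γ]
    {f : ι → β → γ} (hf : ∀ i, Measurable (f i)) {g : β → ι} (hg : Measurable g) :
    Measurable fun b => f (g b) b :=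
  (measurable_from_prod_countable_right (f := fun x : ι × β => f x.1 x.2) hf).comp
    (hg.prodMk measurable_id)

variable {N : ℕ} {p : α → 𝒴 → ℝ≥0} {q : 𝒴 → ℝ≥0} {c : α → ℝ≥0}

theorem measurable_ratio (hp : Measurable (Function.uncurry p)) (hq : Measurable q)
    {f : β → α} {g : β → 𝒴} (hf : Measurable f) (hg : Measurable g) :
    Measurable fun b => ratio (p (f b)) q (g b) := by
  unfold ratio
  exact ((hp.comp (hf.prodMk hg)).coe_nnreal_ennreal).div ((hq.comp hg).coe_nnreal_ennreal)

theorem measurable_candidate [NeZero N] (hp : Measurable (Function.uncurry p))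
    (hq : Measurable q) {f : β → α} {g : β → Fin N → 𝒴 × ℝ} (hf : Measurable f)
    (hg : Measurable g) : Measurable fun b => candidate (p (f b)) q (g b) := by
  refine measurable_argminIdx fun k => ?_
  have hk : Measurable fun b => g b k := (measurable_pi_apply k).comp hg
  exact hk.snd.ennreal_ofReal.div (measurable_ratio hp hq hf hk.fst)

theorem measurableSet_accepts [NeZero N] (hp : Measurable (Function.uncurry p))
    (hq : Measurable q) (hc : Measurable c) {f : β → α} {g : β → (Fin N → 𝒴 × ℝ) × ℝ}
    (hf : Measurable f) (hg : Measurable g) :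
    MeasurableSet {b | Accepts (p (f b)) q (c (f b)) (g b)} := by
  have hk : ∀ k, Measurable fun b => (g b).1 k := fun k =>
    (measurable_pi_apply k).comp hg.fst
  have hz : Measurable fun b => zHat (p (f b)) q (g b).1 :=
    Finset.measurable_fun_sum _ fun k _ => measurable_ratio hp hq hf (hk k).fst
  refine measurableSet_le hg.snd.ennreal_ofReal (hz.div ?_)
  refine measurable_apply_of_countable (f := fun k b => zBar (p (f b)) q (c (f b)) (g b).1 k)
    (fun k => ?_) (measurable_candidate hp hq hf hg.fst)
  exact (hz.add (hc.comp hf).coe_nnreal_ennreal).sub (measurable_ratio hp hq hf (hk k).fst)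

theorem measurable_output [NeZero N] (hp : Measurable (Function.uncurry p))
    (hq : Measurable q) (hc : Measurable c) {f : β → α} {g : β → Randomness N 𝒴}
    (hf : Measurable f) (hg : Measurable g) :
    Measurable fun b => output (p (f b)) q (c (f b)) (g b) := by
  have hi : ∀ i, Measurable fun b => g b i := fun i => (measurable_pi_apply i).comp hg
  have hidx : Measurable fun b => batchIndex (p (f b)) q (c (f b)) (g b) :=
    measurable_sInf_setOf_mem (s := fun i => {b | Accepts (p (f b)) q (c (f b)) (g b i)})
      fun i => measurableSet_accepts hp hq hc hf (hi i)
  refine measurable_apply_of_countable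
    (f := fun i b => ((g b i).1 (candidate (p (f b)) q (g b i).1)).1) (fun i => ?_) hidx
  refine measurable_apply_of_countable (f := fun k b => ((g b i).1 k).1) (fun k => ?_)
    (measurable_candidate hp hq hf (hi i).fst)
  exact ((measurable_pi_apply k).comp (hi i).fst).fst

end Measurability

/-! ### Exponential races and Jensen's inequality for the inverse -/

instance : IsProbabilityMeasure (expMeasure 1) := isProbabilityMeasure_expMeasure one_pos

theorem expMeasure_Iic {s : ℝ} (hs : 0 ≤ s) :
    expMeasure 1 (Set.Iic s) = ENNReal.ofReal (1 - Real.exp (-s)) := by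
  rw [← ofReal_cdf, cdf_expMeasure_eq one_pos, if_pos hs, one_mul]

theorem expMeasure_Ioi {s : ℝ} (hs : 0 ≤ s) :
    expMeasure 1 (Set.Ioi s) = ENNReal.ofReal (Real.exp (-s)) := by
  rw [← Set.compl_Iic, prob_compl_eq_one_sub measurableSet_Iic, expMeasure_Iic hs,
    ← ENNReal.ofReal_one, ← ENNReal.ofReal_sub _ (by simpa using hs)]
  congr 1
  ring

theorem expMeasure_Ici {s : ℝ} (hs : 0 ≤ s) :
    expMeasure 1 (Set.Ici s) = ENNReal.ofReal (Real.exp (-s)) := by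
  have : NullSingletonClass (expMeasure 1) := by
    unfold expMeasure gammaMeasure
    infer_instance
  rw [← expMeasure_Ioi hs]
  exact (measure_congr Ioi_ae_eq_Ici).symm

theorem ae_pos_expMeasure : ∀ᵐ s ∂(expMeasure 1), 0 < s := by
  rw [ae_iff]
  simpa [Set.Iic] using expMeasure_Iic le_rfl

theorem measurable_exponentialPDF (r : ℝ) : Measurable (exponentialPDF r) :=
  (measurable_exponentialPDFReal r).ennreal_ofReal

theorem lintegral_exp_neg_mul_expMeasure (R : ℝ≥0) :
    ∫⁻ s, ENNReal.ofReal (Real.exp (-(s * R))) ∂(expMeasure 1) = (1 + (R : ℝ≥0∞))⁻¹ := by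
  have hR : (0 : ℝ) < 1 + R := by positivity
  have h1 : ∫⁻ s, ENNReal.ofReal (Real.exp (-(s * R))) ∂(expMeasure 1) =
      ∫⁻ s, exponentialPDF 1 s * ENNReal.ofReal (Real.exp (-(s * R))) := by
    have : expMeasure 1 = volume.withDensity (exponentialPDF 1) := rfl
    rw [this, lintegral_withDensity_eq_lintegral_mul _ (measurable_exponentialPDF 1)
      (by fun_prop)]
    rfl
  have h2 : ∀ s, exponentialPDF 1 s * ENNReal.ofReal (Real.exp (-(s * R))) =
      (1 + (R : ℝ≥0∞))⁻¹ * exponentialPDF (1 + R) s := by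
    intro s
    have hinv : (1 + (R : ℝ≥0∞))⁻¹ = ENNReal.ofReal (1 + R)⁻¹ := by
      rw [ENNReal.ofReal_inv_of_pos hR, ENNReal.ofReal_add zero_le_one (NNReal.coe_nonneg R)]
      simp
    rw [exponentialPDF_eq, exponentialPDF_eq, hinv]
    split_ifs with hs
    · rw [← ENNReal.ofReal_mul (by positivity), ← ENNReal.ofReal_mul (by positivity),
        ← mul_assoc, inv_mul_cancel₀ hR.ne', one_mul, one_mul, one_mul, ← Real.exp_add]
      congr 2
      ring
    · simp
  rw [h1, lintegral_congr h2, lintegral_const_mul _ (measurable_exponentialPDF _),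
    lintegral_exponentialPDF_eq_one hR, mul_one]

theorem pi_expMeasure_lt {n : ℕ} (r : Fin n → ℝ≥0) {s : ℝ} (hs : 0 ≤ s) :
    (Measure.pi fun _ : Fin n => expMeasure 1) {S | ∀ l, s * r l < S l} =
      ENNReal.ofReal (Real.exp (-(s * (∑ l, r l : ℝ≥0)))) := by
  have : {S : Fin n → ℝ | ∀ l, s * r l < S l} = Set.univ.pi fun l => Set.Ioi (s * r l) := by
    ext S; simp
  rw [this, Measure.pi_pi]
  rw [Finset.prod_congr rfl fun l _ => expMeasure_Ioi (mul_nonneg hs (NNReal.coe_nonneg (r l)))]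
  rw [← ENNReal.ofReal_prod_of_nonneg fun _ _ => (Real.exp_pos _).le, ← Real.exp_sum]
  simp [Finset.mul_sum]

theorem pi_expMeasure_le {n : ℕ} (r : Fin n → ℝ≥0) {s : ℝ} (hs : 0 ≤ s) :
    (Measure.pi fun _ : Fin n => expMeasure 1) {S | ∀ l, s * r l ≤ S l} =
      ENNReal.ofReal (Real.exp (-(s * (∑ l, r l : ℝ≥0)))) := by
  have : {S : Fin n → ℝ | ∀ l, s * r l ≤ S l} = Set.univ.pi fun l => Set.Ici (s * r l) := by
    ext S; simp [Pi.le_def]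
  rw [this, Measure.pi_pi]
  rw [Finset.prod_congr rfl fun l _ => expMeasure_Ici (mul_nonneg hs (NNReal.coe_nonneg (r l)))]
  rw [← ENNReal.ofReal_prod_of_nonneg fun _ _ => (Real.exp_pos _).le, ← Real.exp_sum]
  simp [Finset.mul_sum]

/-- The law of `(s, S)`, where `s` and the coordinates of `S` are independent and exponential. -/
abbrev clockLaw (n : ℕ) : Measure (ℝ × (Fin n → ℝ)) :=
  (expMeasure 1).prod (Measure.pi fun _ : Fin n => expMeasure 1)

/-- The exponential race: the clock `s` rings before all the clocks `S l / r l` with probability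
`1 / (1 + ∑ l, r l)`. -/
theorem clockLaw_lt {n : ℕ} (r : Fin n → ℝ≥0) :
    clockLaw n {x | 0 < x.1 ∧ ∀ l, x.1 * r l < x.2 l} = (1 + ((∑ l, r l : ℝ≥0) : ℝ≥0∞))⁻¹ := by
  have hm : MeasurableSet {x : ℝ × (Fin n → ℝ) | 0 < x.1 ∧ ∀ l, x.1 * r l < x.2 l} := by
    have h : MeasurableSet {x : ℝ × (Fin n → ℝ) | ∀ l, x.1 * r l < x.2 l} := by
      rw [Set.ofPred_forall]
      exact MeasurableSet.iInter fun l => measurableSet_lt (by fun_prop) (by fun_prop)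
    exact (measurableSet_lt measurable_const measurable_fst).inter h
  rw [Measure.prod_apply hm, ← lintegral_exp_neg_mul_expMeasure]
  refine lintegral_congr_ae ?_
  filter_upwards [ae_pos_expMeasure] with s hs
  rw [← pi_expMeasure_lt r hs.le]
  simp [Set.preimage, hs]

theorem clockLaw_le {n : ℕ} (r : Fin n → ℝ≥0) :
    clockLaw n {x | ∀ l, x.1 * r l ≤ x.2 l} = (1 + ((∑ l, r l : ℝ≥0) : ℝ≥0∞))⁻¹ := by
  have hm : MeasurableSet {x : ℝ × (Fin n → ℝ) | ∀ l, x.1 * r l ≤ x.2 l} := by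
    rw [Set.ofPred_forall]
    exact MeasurableSet.iInter fun l => measurableSet_le (by fun_prop) (by fun_prop)
  rw [Measure.prod_apply hm, ← lintegral_exp_neg_mul_expMeasure]
  refine lintegral_congr_ae ?_
  filter_upwards [ae_pos_expMeasure] with s hs
  rw [← pi_expMeasure_le r hs.le]
  simp [Set.preimage]

/-- The uniform law on `(0, 1)`. -/
abbrev unifLaw : Measure ℝ := (volume : Measure ℝ).restrict (Set.Ioo 0 1)

instance : IsProbabilityMeasure unifLaw := ⟨by simp⟩

theorem ae_pos_unifLaw : ∀ᵐ u ∂unifLaw, 0 < u :=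
  (ae_restrict_mem measurableSet_Ioo).mono fun _ h => h.1

theorem unifLaw_le {t : ℝ≥0∞} (ht : t ≤ 1) : unifLaw {u | ENNReal.ofReal u ≤ t} = t := by
  lift t to ℝ≥0 using ne_top_of_le_ne_top ENNReal.one_ne_top ht
  have ht' : (t : ℝ) ≤ 1 := by exact_mod_cast ht
  have hs : {u | ENNReal.ofReal u ≤ (t : ℝ≥0∞)} = Set.Iic (t : ℝ) := by
    ext u
    simp [ENNReal.ofReal, Real.toNNReal_le_iff_le_coe]
  rw [hs, unifLaw, Measure.restrict_congr_set Ioo_ae_eq_Ioc,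
    Measure.restrict_apply measurableSet_Iic]
  have : Set.Iic (t : ℝ) ∩ Set.Ioc 0 1 = Set.Ioc 0 (t : ℝ) := by
    ext u
    simp only [Set.mem_inter_iff, Set.mem_Iic, Set.mem_Ioc]
    constructor
    · rintro ⟨h1, h2, h3⟩; exact ⟨h2, h1⟩
    · rintro ⟨h1, h2⟩; exact ⟨h2, h1, h2.trans ht'⟩
  rw [this, Real.volume_Ioc, sub_zero, ENNReal.ofReal_coe_nnreal]

/-- Jensen's inequality for the convex function `t ↦ t⁻¹` on `[0, ∞]`. -/
theorem inv_lintegral_le_lintegral_inv {β : Type*} [MeasurableSpace β] (μ : Measure β)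
    [IsProbabilityMeasure μ] {f : β → ℝ≥0∞} (hf : Measurable f) :
    (∫⁻ b, f b ∂μ)⁻¹ ≤ ∫⁻ b, (f b)⁻¹ ∂μ := by
  set m := ∫⁻ b, f b ∂μ with hm
  rcases eq_or_ne m ∞ with h | htop
  · simp [h]
  rcases eq_or_ne m 0 with h0 | h0
  · have h1 : f =ᵐ[μ] 0 := (lintegral_eq_zero_iff hf).1 h0
    have : ∫⁻ b, (f b)⁻¹ ∂μ = ∫⁻ _, ∞ ∂μ :=
      lintegral_congr_ae (h1.mono fun b hb => by simp [hb])
    rw [this]; simp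
  -- the tangent line of `t ↦ t⁻¹` at `m`
  have key : ∀ b, 2 * m⁻¹ ≤ (f b)⁻¹ + (m⁻¹ * m⁻¹) * f b := by
    intro b
    rcases eq_or_ne (f b) 0 with hb | hb
    · simp [hb]
    rcases eq_or_ne (f b) ∞ with hb' | hb'
    · rw [hb', ENNReal.mul_top (by simpa using htop)]; simp
    generalize f b = t at hb hb'
    lift t to ℝ≥0 using hb'
    generalize m = m' at h0 htop
    lift m' to ℝ≥0 using htop
    have h0' : m' ≠ 0 := by exact_mod_cast h0
    have hb' : t ≠ 0 := by exact_mod_cast hb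
    rw [← ENNReal.coe_inv h0', ← ENNReal.coe_inv hb']
    have : 2 * m'⁻¹ ≤ t⁻¹ + m'⁻¹ * m'⁻¹ * t := by
      have hm0 : (0 : ℝ) < m' := by positivity
      have ht0 : (0 : ℝ) < t := by positivity
      rw [← NNReal.coe_le_coe]
      push_cast
      have : ((t : ℝ)⁻¹ + (m' : ℝ)⁻¹ * (m' : ℝ)⁻¹ * t) - 2 * (m' : ℝ)⁻¹ =
          (t : ℝ)⁻¹ * ((m' : ℝ)⁻¹ * (t - m')) ^ 2 := by
        field_simp
        ring
      have h3 : 0 ≤ (t : ℝ)⁻¹ * ((m' : ℝ)⁻¹ * (t - m')) ^ 2 := by positivity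
      linarith
    exact_mod_cast this
  have h2 : 2 * m⁻¹ ≤ ∫⁻ b, (f b)⁻¹ ∂μ + m⁻¹ := by
    calc 2 * m⁻¹ = ∫⁻ _, 2 * m⁻¹ ∂μ := by simp
      _ ≤ ∫⁻ b, (f b)⁻¹ + (m⁻¹ * m⁻¹) * f b ∂μ := lintegral_mono key
      _ = ∫⁻ b, (f b)⁻¹ ∂μ + m⁻¹ * m⁻¹ * m := by
        rw [lintegral_add_right _ (hf.const_mul _), lintegral_const_mul _ hf]
      _ = _ := by rw [mul_assoc, ENNReal.inv_mul_cancel h0 htop, mul_one]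
  rw [two_mul] at h2
  exact (ENNReal.add_le_add_iff_right (ENNReal.inv_ne_top.2 h0)).1 h2

/-- The inequality between the harmonic and the arithmetic mean. -/
theorem inv_sum_le_sum_inv {m : ℕ} (hm : m ≠ 0) (b : Fin m → ℝ≥0∞) :
    (∑ i, b i)⁻¹ ≤ (m : ℝ≥0∞)⁻¹ * ((m : ℝ≥0∞)⁻¹ * ∑ i, (b i)⁻¹) := by
  have hm0 : (m : ℝ≥0∞) ≠ 0 := by exact_mod_cast hm
  have hmt : (m : ℝ≥0∞) ≠ ∞ := ENNReal.natCast_ne_top m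
  have : IsProbabilityMeasure ((m : ℝ≥0∞)⁻¹ • (Measure.count : Measure (Fin m))) := by
    refine ⟨?_⟩
    simp [Measure.count_univ, ENNReal.inv_mul_cancel hm0 hmt]
  have h := inv_lintegral_le_lintegral_inv ((m : ℝ≥0∞)⁻¹ • (Measure.count : Measure (Fin m)))
    (measurable_of_finite b)
  simp only [lintegral_smul_measure, lintegral_count, tsum_fintype, smul_eq_mul] at h
  rw [ENNReal.mul_inv (Or.inl (ENNReal.inv_ne_zero.2 hmt)) (Or.inl (ENNReal.inv_ne_top.2 hm0)),
    inv_inv] at h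
  calc (∑ i, b i)⁻¹ = (m : ℝ≥0∞)⁻¹ * (m * (∑ i, b i)⁻¹) := by
        rw [← mul_assoc, ENNReal.inv_mul_cancel hm0 hmt, one_mul]
    _ ≤ _ := by gcongr

/-! ### Expectations over independent proposals -/

section Product

variable {γ : Type*} [MeasurableSpace γ] (Q : Measure γ) [IsProbabilityMeasure Q]

theorem lintegral_pi_eval {n : ℕ} {f : γ → ℝ≥0∞} (hf : Measurable f) (l : Fin n) :
    ∫⁻ Y, f (Y l) ∂(Measure.pi fun _ : Fin n => Q) = ∫⁻ y, f y ∂Q :=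
  (measurePreserving_eval (fun _ : Fin n => Q) l).lintegral_comp hf

theorem lintegral_pi_sum {n : ℕ} {f : γ → ℝ≥0∞} (hf : Measurable f) :
    ∫⁻ Y, ∑ l, f (Y l) ∂(Measure.pi fun _ : Fin n => Q) = n * ∫⁻ y, f y ∂Q := by
  have hm : ∀ l : Fin n, Measurable fun Y : Fin n → γ => f (Y l) := fun l =>
    hf.comp (measurable_pi_apply l)
  rw [lintegral_finsetSum _ fun l _ => hm l]
  simp [lintegral_pi_eval Q hf]

theorem measurable_insertNth {n : ℕ} (j : Fin (n + 1)) :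
    Measurable fun x : γ × (Fin n → γ) => (j.insertNth x.1 x.2 : Fin (n + 1) → γ) :=
  (MeasurableEquiv.piFinSuccAbove (fun _ : Fin (n + 1) => γ) j).symm.measurable

theorem lintegral_pi_insertNth {n : ℕ} (j : Fin (n + 1)) {F : (Fin (n + 1) → γ) → ℝ≥0∞}
    (hF : Measurable F) :
    ∫⁻ Y, F Y ∂(Measure.pi fun _ : Fin (n + 1) => Q) =
      ∫⁻ y, ∫⁻ Y, F (j.insertNth y Y) ∂(Measure.pi fun _ : Fin n => Q) ∂Q := by
  have h := (measurePreserving_piFinSuccAbove (fun _ : Fin (n + 1) => Q) j).symm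
  rw [← h.lintegral_comp hF]
  exact lintegral_prod _ (hF.comp h.measurable).aemeasurable

theorem lintegral_pi_inv_sum_le {n : ℕ} (hn : n ≠ 0) {b : γ → ℝ≥0∞} (hb : Measurable b) :
    ∫⁻ Y, (∑ l, b (Y l))⁻¹ ∂(Measure.pi fun _ : Fin n => Q) ≤
      (n : ℝ≥0∞)⁻¹ * ∫⁻ y, (b y)⁻¹ ∂Q := by
  have hn0 : (n : ℝ≥0∞) ≠ 0 := by exact_mod_cast hn
  have hbi : Measurable fun y => (b y)⁻¹ := hb.inv
  have hm : Measurable fun Y : Fin n → γ => ∑ l, (b (Y l))⁻¹ :=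
    Finset.measurable_fun_sum _ fun l _ => hbi.comp (measurable_pi_apply l)
  calc _ ≤ ∫⁻ Y, (n : ℝ≥0∞)⁻¹ * ((n : ℝ≥0∞)⁻¹ * ∑ l, (b (Y l))⁻¹)
          ∂(Measure.pi fun _ : Fin n => Q) :=
        lintegral_mono fun Y => inv_sum_le_sum_inv hn _
    _ = (n : ℝ≥0∞)⁻¹ * ((n : ℝ≥0∞)⁻¹ * (n * ∫⁻ y, (b y)⁻¹ ∂Q)) := by
        rw [lintegral_const_mul _ (hm.const_mul _), lintegral_const_mul _ hm,
          lintegral_pi_sum Q hbi]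
    _ = _ := by
        rw [← mul_assoc (n : ℝ≥0∞)⁻¹ n,
          ENNReal.inv_mul_cancel hn0 (ENNReal.natCast_ne_top n), one_mul]

/-- For `n ≥ 2` the summand `l` of the numerator is decoupled from the denominator by dropping
`b (Y l)` there; the remaining `n - 1` terms are handled by the harmonic-arithmetic mean
inequality, and `n / (n - 1) ≤ 2`. For `n = 1` only the bound `a ≤ ω` is available. -/
theorem lintegral_pi_sum_div_sum_le {n : ℕ} (hn : 1 ≤ n) {a b : γ → ℝ≥0∞} (ha : Measurable a)
    (hb : Measurable b) {ω : ℝ≥0} (haω : ∀ y, a y ≤ ω) (ha1 : ∫⁻ y, a y ∂Q = 1) :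
    ∫⁻ Y, (∑ l, a (Y l)) * (∑ l, b (Y l))⁻¹ ∂(Measure.pi fun _ : Fin n => Q) ≤
      ind (n + 1) 2 ω * ∫⁻ y, (b y)⁻¹ ∂Q := by
  have hbi : Measurable fun y => (b y)⁻¹ := hb.inv
  rcases hn.eq_or_lt with rfl | h2
  · have : ind (1 + 1) 2 ω = ω := by simp [ind]
    rw [this, ← lintegral_const_mul _ hbi,
      ← lintegral_pi_eval Q (hbi.const_mul _) (0 : Fin 1)]
    refine lintegral_mono fun Y => ?_
    simp only [Finset.univ_unique, Fin.default_eq_zero, Finset.sum_singleton]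
    gcongr
    exact haω _
  · obtain ⟨m, rfl⟩ : ∃ m, n = m + 1 := ⟨n - 1, by omega⟩
    have hm : m ≠ 0 := by omega
    have hind : ind (m + 1 + 1) 2 ω = 2 := by
      simp [ind, show 2 < m + 1 + 1 by omega, hm]
    have hB : ∀ k, Measurable fun Y : Fin k → γ => (∑ l, b (Y l))⁻¹ := fun k =>
      (Finset.measurable_fun_sum _ fun l _ => hb.comp (measurable_pi_apply l)).inv
    have hmul : ∀ l : Fin (m + 1),
        Measurable fun Y : Fin (m + 1) → γ => a (Y l) * (∑ l, b (Y l))⁻¹ := fun l =>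
      (ha.comp (measurable_pi_apply l)).mul (hB _)
    have hterm : ∀ l : Fin (m + 1),
        ∫⁻ Y, a (Y l) * (∑ l, b (Y l))⁻¹ ∂(Measure.pi fun _ : Fin (m + 1) => Q) ≤
          (m : ℝ≥0∞)⁻¹ * ∫⁻ y, (b y)⁻¹ ∂Q := by
      intro l
      rw [lintegral_pi_insertNth Q l (hmul l)]
      calc _ ≤ ∫⁻ y, ∫⁻ Y, a y * (∑ i, b (Y i))⁻¹ ∂(Measure.pi fun _ : Fin m => Q) ∂Q := by
            refine lintegral_mono fun y => lintegral_mono fun Y => ?_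
            simp only [Fin.insertNth_apply_same, Fin.sum_univ_succAbove _ l,
              Fin.insertNth_apply_succAbove]
            gcongr
            exact le_add_self
        _ = ∫⁻ Y, (∑ i, b (Y i))⁻¹ ∂(Measure.pi fun _ : Fin m => Q) := by
            simp_rw [lintegral_const_mul _ (hB m)]
            rw [lintegral_mul_const _ ha, ha1, one_mul]
        _ ≤ _ := lintegral_pi_inv_sum_le Q hm hb
    simp_rw [Finset.sum_mul]
    rw [lintegral_finsetSum _ fun l _ => hmul l, hind]
    refine (Finset.sum_le_sum fun l _ => hterm l).trans ?_
    rw [Finset.sum_const, Finset.card_univ, Fintype.card_fin, nsmul_eq_mul, ← mul_assoc]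
    gcongr
    have hm0 : (m : ℝ≥0∞) ≠ 0 := by exact_mod_cast hm
    rw [← div_eq_mul_inv, ENNReal.div_le_iff hm0 (ENNReal.natCast_ne_top m)]
    exact_mod_cast (by omega : m + 1 ≤ 2 * m)

end Product

/-! ### Splitting off one proposal of a batch -/

section Batch

/-- The batch with proposal `y` at position `j`, the rest being given by `r`. -/
def assemble {𝒴 : Type*} {n : ℕ} (j : Fin (n + 1)) (y : 𝒴)
    (r : (Fin n → 𝒴) × (ℝ × (Fin n → ℝ)) × ℝ) :
    (Fin (n + 1) → 𝒴 × ℝ) × ℝ :=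
  (j.insertNth (y, r.2.1.1) fun l => (r.1 l, r.2.1.2 l), r.2.2)

theorem assemble_fst_apply_fst {𝒴 : Type*} {n : ℕ} (j : Fin (n + 1)) (y : 𝒴)
    (r : (Fin n → 𝒴) × (ℝ × (Fin n → ℝ)) × ℝ) : ((assemble j y r).1 j).1 = y := by
  simp [assemble]

variable {𝒴 : Type*} [MeasurableSpace 𝒴]

/-- The law of one pair (batch, uniform variable). -/
abbrev batchLaw (N : ℕ) (Q : Measure 𝒴) : Measure ((Fin N → 𝒴 × ℝ) × ℝ) :=
  (Measure.pi fun _ : Fin N => Q.prod (expMeasure 1)).prod unifLaw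

/-- The law of everything in a batch of size `n + 1` except one proposal: the other `n` proposals,
the exponential variable of the excluded proposal with those of the other ones, and the uniform
variable. -/
abbrev othersLaw (n : ℕ) (Q : Measure 𝒴) : Measure ((Fin n → 𝒴) × (ℝ × (Fin n → ℝ)) × ℝ) :=
  (Measure.pi fun _ : Fin n => Q).prod ((clockLaw n).prod unifLaw)

theorem measurable_assemble {n : ℕ} (j : Fin (n + 1)) :
    Measurable fun x : 𝒴 × ((Fin n → 𝒴) × (ℝ × (Fin n → ℝ)) × ℝ) => assemble j x.1 x.2 := by
  unfold assemble
  refine Measurable.prodMk ?_ (by fun_prop)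
  refine (measurable_insertNth j).comp (f := fun x : 𝒴 × ((Fin n → 𝒴) × (ℝ × (Fin n → ℝ)) × ℝ) =>
    ((x.1, x.2.2.1.1), fun l => (x.2.1 l, x.2.2.1.2 l))) ?_
  fun_prop

/-- Integration over a batch by first integrating over the proposal at position `j`. -/
theorem lintegral_batchLaw (Q : Measure 𝒴) [IsProbabilityMeasure Q] {n : ℕ} (j : Fin (n + 1))
    {F : (Fin (n + 1) → 𝒴 × ℝ) × ℝ → ℝ≥0∞} (hF : Measurable F) :
    ∫⁻ a, F a ∂(batchLaw (n + 1) Q) = ∫⁻ y, ∫⁻ r, F (assemble j y r) ∂(othersLaw n Q) ∂Q := by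
  have hG : Measurable fun x : ((𝒴 × ℝ) × (Fin n → 𝒴 × ℝ)) × ℝ =>
      F (j.insertNth x.1.1 x.1.2, x.2) :=
    hF.comp (((measurable_insertNth j).comp measurable_fst).prodMk measurable_snd)
  have hI := hG.lintegral_prod_right' (ν := unifLaw)
  have hH := hI.lintegral_prod_right' (ν := Measure.pi fun _ : Fin n => Q.prod (expMeasure 1))
  have hFa : ∀ y, Measurable fun r => F (assemble j y r) := fun y =>
    hF.comp ((measurable_assemble j).comp measurable_prodMk_left)
  rw [lintegral_prod _ hF.aemeasurable,
    lintegral_pi_insertNth _ j hF.lintegral_prod_right',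
    lintegral_prod _ hH.aemeasurable]
  refine lintegral_congr fun y => ?_
  have harr := measurePreserving_arrowProdEquivProdArrow 𝒴 ℝ (Fin n) (fun _ => Q)
    (fun _ => expMeasure 1)
  have hK : Measurable fun x : (Fin n → 𝒴) × ((ℝ × (Fin n → ℝ))) =>
      ∫⁻ u, F (assemble j y (x.1, x.2, u)) ∂unifLaw := by
    refine Measurable.lintegral_prod_right' (ν := unifLaw)
      (f := fun x : ((Fin n → 𝒴) × ((ℝ × (Fin n → ℝ)))) × ℝ =>
        F (assemble j y (x.1.1, x.1.2, x.2))) ((hFa y).comp ?_)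
    fun_prop
  have hK2 : Measurable fun x : ((Fin n → 𝒴) × ℝ) × (Fin n → ℝ) =>
      ∫⁻ u, F (assemble j y (x.1.1, (x.1.2, x.2), u)) ∂unifLaw :=
    hK.comp (g := fun x : (Fin n → 𝒴) × (ℝ × (Fin n → ℝ)) =>
            ∫⁻ u, F (assemble j y (x.1, x.2, u)) ∂unifLaw)
      (f := fun x : ((Fin n → 𝒴) × ℝ) × (Fin n → ℝ) => (x.1.1, (x.1.2, x.2))) (by fun_prop)
  calc _ = ∫⁻ s, ∫⁻ Y, ∫⁻ S, ∫⁻ u, F (assemble j y (Y, (s, S), u)) ∂unifLaw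
        ∂(Measure.pi fun _ : Fin n => expMeasure 1) ∂(Measure.pi fun _ : Fin n => Q)
        ∂(expMeasure 1) := by
        refine lintegral_congr fun s => ?_
        have hKs : Measurable fun x : (Fin n → 𝒴) × (Fin n → ℝ) =>
            ∫⁻ u, F (assemble j y (x.1, (s, x.2), u)) ∂unifLaw :=
          hK.comp (g := fun x : (Fin n → 𝒴) × (ℝ × (Fin n → ℝ)) =>
            ∫⁻ u, F (assemble j y (x.1, x.2, u)) ∂unifLaw)
            (f := fun x : (Fin n → 𝒴) × (Fin n → ℝ) => (x.1, (s, x.2))) (by fun_prop)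
        rw [← lintegral_prod _ hKs.aemeasurable, ← harr.lintegral_comp hKs]
        rfl
    _ = ∫⁻ Y, ∫⁻ s, ∫⁻ S, ∫⁻ u, F (assemble j y (Y, (s, S), u)) ∂unifLaw
        ∂(Measure.pi fun _ : Fin n => expMeasure 1) ∂(expMeasure 1)
        ∂(Measure.pi fun _ : Fin n => Q) := by
        rw [lintegral_lintegral_swap]
        refine Measurable.aemeasurable ?_
        exact (hK2.lintegral_prod_right' (ν := Measure.pi fun _ : Fin n => expMeasure 1)).comp
          measurable_swap
    _ = _ := by
        rw [lintegral_prod _ (hFa y).aemeasurable]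
        refine lintegral_congr fun Y => ?_
        have hFY : Measurable fun x : (ℝ × (Fin n → ℝ)) × ℝ => F (assemble j y (Y, x)) :=
          (hFa y).comp measurable_prodMk_left
        rw [lintegral_prod _ hFY.aemeasurable,
          lintegral_prod _ hFY.lintegral_prod_right'.aemeasurable]

end Batch

section Weight

variable {𝒴 : Type*}

/-- The importance weight `p(y)/q(y)` as a real number. -/
def weight (p q : 𝒴 → ℝ≥0) (y : 𝒴) : ℝ≥0 := p y / q y

variable {p q : 𝒴 → ℝ≥0} {c : ℝ≥0}

theorem ratio_eq_weight (h : ∀ y, p y ≤ c * q y) (y : 𝒴) : ratio p q y = weight p q y := by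
  unfold ratio weight
  rcases eq_or_ne (q y) 0 with hq | hq
  · have : p y = 0 := le_antisymm (by simpa [hq] using h y) zero_le
    simp [hq, this]
  · rw [ENNReal.coe_div hq]

theorem weight_le (h : ∀ y, p y ≤ c * q y) (y : 𝒴) : weight p q y ≤ c :=
  div_le_of_le_mul₀ zero_le zero_le (h y)

variable {n : ℕ}

theorem candidate_eq_of_lt (h : ∀ y, p y ≤ c * q y) (j : Fin (n + 1)) {y : 𝒴} {Y : Fin n → 𝒴}
    {s : ℝ} {S : Fin n → ℝ} (hy : 0 < weight p q y) (hs : 0 < s)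
    (hS : ∀ l, s * (weight p q (Y l) / weight p q y : ℝ≥0) < S l) :
    candidate p q (j.insertNth (y, s) fun l => (Y l, S l) : Fin (n + 1) → 𝒴 × ℝ) = j := by
  refine argminIdx_eq_of_lt _ _ fun i hi => ?_
  obtain ⟨l, rfl⟩ := Fin.exists_succAbove_eq hi
  simp only [Fin.insertNth_apply_same, Fin.insertNth_apply_succAbove, ratio_eq_weight h]
  have hw : (0 : ℝ) < weight p q y := by exact_mod_cast hy
  have hl := hS l
  have hSl : 0 < S l := lt_of_le_of_lt (by positivity) hl
  rcases eq_or_ne (weight p q (Y l)) 0 with h0 | h0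
  · rw [h0, ENNReal.coe_zero, ENNReal.div_zero (by simpa using hSl)]
    exact ENNReal.div_lt_top ENNReal.ofReal_ne_top (by exact_mod_cast hy.ne')
  · have h0' : (0 : ℝ) < weight p q (Y l) := by positivity
    rw [← ENNReal.ofReal_coe_nnreal, ← ENNReal.ofReal_coe_nnreal,
      ← ENNReal.ofReal_div_of_pos hw, ← ENNReal.ofReal_div_of_pos h0',
      ENNReal.ofReal_lt_ofReal_iff (by positivity), lt_div_iff₀ h0']
    calc _ = s * (weight p q (Y l) / weight p q y : ℝ≥0) := by push_cast; ring
      _ < _ := hl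

theorem le_of_candidate_eq (h : ∀ y, p y ≤ c * q y) (j : Fin (n + 1)) {y : 𝒴} {Y : Fin n → 𝒴}
    {s : ℝ} {S : Fin n → ℝ}
    (hc : candidate p q (j.insertNth (y, s) fun l => (Y l, S l) : Fin (n + 1) → 𝒴 × ℝ) = j)
    (l : Fin n) :
    ENNReal.ofReal s / weight p q y ≤ ENNReal.ofReal (S l) / weight p q (Y l) := by
  have := argminIdx_le (fun k => ENNReal.ofReal
    ((j.insertNth (y, s) fun l => (Y l, S l) : Fin (n + 1) → 𝒴 × ℝ) k).2 /
      ratio p q ((j.insertNth (y, s) fun l => (Y l, S l) : Fin (n + 1) → 𝒴 × ℝ) k).1)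
    (j.succAbove l)
  unfold candidate at hc
  rw [hc] at this
  simpa only [Fin.insertNth_apply_same, Fin.insertNth_apply_succAbove, ratio_eq_weight h] using this

theorem mul_div_le_of_candidate_eq (h : ∀ y, p y ≤ c * q y) (j : Fin (n + 1)) {y : 𝒴}
    {Y : Fin n → 𝒴} {s : ℝ} {S : Fin n → ℝ} (hy : 0 < weight p q y) (hs : 0 < s)
    (hc : candidate p q (j.insertNth (y, s) fun l => (Y l, S l) : Fin (n + 1) → 𝒴 × ℝ) = j)
    (l : Fin n) : s * (weight p q (Y l) / weight p q y : ℝ≥0) ≤ S l := by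
  have hl := le_of_candidate_eq h j hc l
  have hw : (0 : ℝ) < weight p q y := by exact_mod_cast hy
  have hSl : 0 < S l := by
    by_contra! hS
    rw [ENNReal.ofReal_of_nonpos hS, ENNReal.zero_div, nonpos_iff_eq_zero,
      ENNReal.div_eq_zero_iff] at hl
    simp [hs.not_ge] at hl
  rcases eq_or_ne (weight p q (Y l)) 0 with h0 | h0
  · simpa [h0] using hSl.le
  · have h0' : (0 : ℝ) < weight p q (Y l) := by positivity
    rw [← ENNReal.ofReal_coe_nnreal, ← ENNReal.ofReal_coe_nnreal,
      ← ENNReal.ofReal_div_of_pos hw, ← ENNReal.ofReal_div_of_pos h0',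
      ENNReal.ofReal_le_ofReal_iff (by positivity), le_div_iff₀ h0'] at hl
    calc s * (weight p q (Y l) / weight p q y : ℝ≥0) = _ := by push_cast; ring
      _ ≤ _ := hl

theorem weight_eq_zero_of_candidate_eq (h : ∀ y, p y ≤ c * q y) (j : Fin (n + 1)) {y : 𝒴}
    {Y : Fin n → 𝒴} {s : ℝ} {S : Fin n → ℝ} (hy : weight p q y = 0) (hs : 0 < s)
    (hc : candidate p q (j.insertNth (y, s) fun l => (Y l, S l) : Fin (n + 1) → 𝒴 × ℝ) = j)
    (l : Fin n) : weight p q (Y l) = 0 := by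
  have hl := le_of_candidate_eq h j hc l
  rw [hy, ENNReal.coe_zero, ENNReal.div_zero (by simpa using hs), top_le_iff] at hl
  by_contra h0
  exact (ENNReal.div_lt_top ENNReal.ofReal_ne_top (by exact_mod_cast h0)).ne hl

theorem accepts_assemble_iff (h : ∀ y, p y ≤ c * q y) (j : Fin (n + 1)) {y : 𝒴}
    {r : (Fin n → 𝒴) × (ℝ × (Fin n → ℝ)) × ℝ} (hc : candidate p q (assemble j y r).1 = j) :
    Accepts p q c (assemble j y r) ↔ ENNReal.ofReal r.2.2 ≤
      ((weight p q y + ∑ l, weight p q (r.1 l) : ℝ≥0) : ℝ≥0∞) /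
        (∑ l, weight p q (r.1 l) + c : ℝ≥0) := by
  have hz : zHat p q (assemble j y r).1 =
      ((weight p q y + ∑ l, weight p q (r.1 l) : ℝ≥0) : ℝ≥0∞) := by
    simp only [zHat, assemble, Fin.sum_univ_succAbove _ j, Fin.insertNth_apply_same,
      Fin.insertNth_apply_succAbove, ratio_eq_weight h]
    push_cast
    rfl
  have hb : zBar p q c (assemble j y r).1 j = (∑ l, weight p q (r.1 l) + c : ℝ≥0) := by
    rw [zBar, hz, assemble_fst_apply_fst, ratio_eq_weight h, ← ENNReal.coe_add,
      ← ENNReal.coe_sub, add_assoc, add_tsub_cancel_left]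
  rw [Accepts, hc, hz, hb]
  rfl

end Weight

/-! ### Selection probabilities given one proposal -/

section Selection

variable {𝒴 : Type*} {n : ℕ}

/-- The event that a pair (batch, uniform variable) is accepted and proposal `j` is its
candidate. -/
def selected {N : ℕ} [NeZero N] (p q : 𝒴 → ℝ≥0) (c : ℝ≥0) (j : Fin N) :
    Set ((Fin N → 𝒴 × ℝ) × ℝ) :=
  {a | Accepts p q c a ∧ candidate p q a.1 = j}

/-- The total weight of the proposals `Y`. -/
def totalWeight (p q : 𝒴 → ℝ≥0) (Y : Fin n → 𝒴) : ℝ≥0 := ∑ l, weight p q (Y l)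

/-- The probability that a batch is accepted when its candidate has weight `w` and the other
proposals have total weight `t`. -/
def acceptProb (c w t : ℝ≥0) : ℝ≥0 := (w + t) / (t + c)

theorem acceptProb_le_one {c w : ℝ≥0} (h : w ≤ c) (t : ℝ≥0) : acceptProb c w t ≤ 1 :=
  div_le_one_of_le₀ (by rw [add_comm t]; gcongr) zero_le

theorem coe_acceptProb {c w : ℝ≥0} (hw : 0 < w) (h : w ≤ c) (t : ℝ≥0) :
    (acceptProb c w t : ℝ≥0∞) = ((w + t : ℝ≥0) : ℝ≥0∞) / (t + c : ℝ≥0) :=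
  ENNReal.coe_div (add_pos_of_nonneg_of_pos zero_le (hw.trans_le h)).ne'

/-- The winning probability of a clock of rate `w` against clocks of total rate `t`, times the
acceptance probability. -/
theorem race_mul_acceptProb {c w : ℝ≥0} (hw : 0 < w) (t : ℝ≥0) :
    (1 + t / w)⁻¹ * acceptProb c w t = w * (t + c)⁻¹ := by
  have h : w + t ≠ 0 := (add_pos_of_pos_of_nonneg hw zero_le).ne'
  have : 1 + t / w = (w + t) / w := by field_simp
  rw [this, acceptProb, inv_div, div_mul_div_comm, mul_comm w (w + t),
    mul_div_mul_left _ _ h, div_eq_mul_inv]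

variable [MeasurableSpace 𝒴] {p q pA pB : 𝒴 → ℝ≥0} {c cA cB : ℝ≥0}

theorem measurable_weight (hp : Measurable p) (hq : Measurable q) : Measurable (weight p q) :=
  hp.div hq

theorem measurable_totalWeight (hp : Measurable p) (hq : Measurable q) :
    Measurable (totalWeight p q : (Fin n → 𝒴) → ℝ≥0) :=
  Finset.measurable_fun_sum _ fun l _ => (measurable_weight hp hq).comp (measurable_pi_apply l)

theorem measurableSet_selected {N : ℕ} [NeZero N] (hp : Measurable p) (hq : Measurable q)
    (j : Fin N) : MeasurableSet (selected p q c j) := by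
  have hp' : Measurable (Function.uncurry fun _ : Unit => p) := hp.comp measurable_snd
  have h1 := measurableSet_accepts (N := N) (c := fun _ => c) hp' hq measurable_const
    (f := fun _ : (Fin N → 𝒴 × ℝ) × ℝ => ()) measurable_const measurable_id
  have h2 := measurable_candidate (N := N) hp' hq
    (f := fun _ : (Fin N → 𝒴 × ℝ) × ℝ => ()) measurable_const measurable_fst
  exact h1.inter (h2 (measurableSet_singleton j))

/-- Together with `le_othersLaw_selected`: given that proposal `j` equals `y`, it is selected with
probability proportional to its weight. The normalizations `1 / (w + t)` of the race and `w + t` of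
the acceptance probability cancel. -/
theorem othersLaw_selected_le (Q : Measure 𝒴) [IsProbabilityMeasure Q] (hp : Measurable p)
    (hq : Measurable q) (h : ∀ y, p y ≤ c * q y) (j : Fin (n + 1)) (y : 𝒴) :
    othersLaw n Q {r | assemble j y r ∈ selected p q c j} ≤
      weight p q y * ∫⁻ Y, (((totalWeight p q Y + c)⁻¹ : ℝ≥0) : ℝ≥0∞)
        ∂(Measure.pi fun _ : Fin n => Q) := by
  have hmeas : MeasurableSet {r | assemble j y r ∈ selected p q c j} :=
    (measurable_assemble j).comp measurable_prodMk_left (measurableSet_selected hp hq j)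
  have hpos : ∀ᵐ x ∂((clockLaw n).prod unifLaw), 0 < x.1.1 ∧ 0 < x.2 := by
    have h1 : ∀ᵐ x ∂(clockLaw n), 0 < x.1 :=
      Measure.quasiMeasurePreserving_fst.ae ae_pos_expMeasure
    exact (Measure.quasiMeasurePreserving_fst.ae h1).and
      (Measure.quasiMeasurePreserving_snd.ae ae_pos_unifLaw)
  rw [Measure.prod_apply hmeas, ← lintegral_const_mul' _ _ ENNReal.coe_ne_top]
  refine lintegral_mono fun Y => ?_
  rcases eq_zero_or_pos (weight p q y) with hy | hy
  · -- a candidate of weight zero forces all weights to vanish, and the batch is then rejected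
    rw [hy, ENNReal.coe_zero, zero_mul, nonpos_iff_eq_zero, measure_eq_zero_iff_ae_notMem]
    filter_upwards [hpos] with x hx hmem
    obtain ⟨hacc, hcand⟩ := hmem
    rw [accepts_assemble_iff h j hcand, hy] at hacc
    have hz : ∑ l, weight p q (Y l) = 0 := Finset.sum_eq_zero fun l _ =>
      weight_eq_zero_of_candidate_eq h j hy hx.1 hcand l
    simp only [hz, add_zero, ENNReal.coe_zero, ENNReal.zero_div, nonpos_iff_eq_zero,
      ENNReal.ofReal_eq_zero] at hacc
    exact hx.2.not_ge hacc
  · set t := totalWeight p q Y with ht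
    have hsub : (Prod.mk Y ⁻¹' {r | assemble j y r ∈ selected p q c j} :
        Set ((ℝ × (Fin n → ℝ)) × ℝ)) ≤ᵐ[(clockLaw n).prod unifLaw]
        {x : ℝ × (Fin n → ℝ) | ∀ l, x.1 * (weight p q (Y l) / weight p q y : ℝ≥0) ≤ x.2 l} ×ˢ
          {u | ENNReal.ofReal u ≤ acceptProb c (weight p q y) t} := by
      filter_upwards [hpos] with x hx hmem
      obtain ⟨hacc, hcand⟩ := hmem
      refine ⟨fun l => mul_div_le_of_candidate_eq h j hy hx.1 hcand l, ?_⟩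
      rw [accepts_assemble_iff h j hcand] at hacc
      rw [Set.mem_ofPred_eq, coe_acceptProb hy (weight_le h y)]
      exact hacc
    refine (measure_mono_ae hsub).trans ?_
    rw [Measure.prod_prod, clockLaw_le,
      unifLaw_le (by exact_mod_cast acceptProb_le_one (weight_le h y) t), ← Finset.sum_div]
    have h0 : (1 : ℝ≥0) + (∑ l, weight p q (Y l)) / weight p q y ≠ 0 :=
      (add_pos_of_pos_of_nonneg one_pos zero_le).ne'
    rw [← ENNReal.coe_one, ← ENNReal.coe_add, ← ENNReal.coe_inv h0, ← ENNReal.coe_mul,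
      ← ENNReal.coe_mul]
    exact_mod_cast (race_mul_acceptProb hy t).le

/-- Two runs on the same batch both select proposal `j` as soon as its clock wins the race in
which every competitor has the larger of its two relative weights, and the uniform variable lies
below both acceptance probabilities. -/
theorem le_othersLaw_selected_inter (Q : Measure 𝒴) [IsProbabilityMeasure Q]
    (hpA : Measurable pA) (hpB : Measurable pB) (hq : Measurable q)
    (hA : ∀ y, pA y ≤ cA * q y) (hB : ∀ y, pB y ≤ cB * q y)
    (j : Fin (n + 1)) {y : 𝒴} (hyA : 0 < weight pA q y) (hyB : 0 < weight pB q y) :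
    ∫⁻ Y, (((1 + ∑ l, max (weight pA q (Y l) / weight pA q y)
          (weight pB q (Y l) / weight pB q y))⁻¹ *
        min (acceptProb cA (weight pA q y) (totalWeight pA q Y))
          (acceptProb cB (weight pB q y) (totalWeight pB q Y)) : ℝ≥0) : ℝ≥0∞)
        ∂(Measure.pi fun _ : Fin n => Q) ≤
      othersLaw n Q {r | assemble j y r ∈ selected pA q cA j ∩ selected pB q cB j} := by
  have hmeas : MeasurableSet {r | assemble j y r ∈ selected pA q cA j ∩ selected pB q cB j} :=
    (measurable_assemble j).comp measurable_prodMk_left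
      ((measurableSet_selected (c := cA) hpA hq j).inter
        (measurableSet_selected (c := cB) hpB hq j))
  rw [Measure.prod_apply hmeas]
  refine lintegral_mono fun Y => ?_
  set m : Fin n → ℝ≥0 := fun l => max (weight pA q (Y l) / weight pA q y)
    (weight pB q (Y l) / weight pB q y) with hm
  set tA := acceptProb cA (weight pA q y) (totalWeight pA q Y) with htA
  set tB := acceptProb cB (weight pB q y) (totalWeight pB q Y) with htB
  have hsub : {x : ℝ × (Fin n → ℝ) | 0 < x.1 ∧ ∀ l, x.1 * m l < x.2 l} ×ˢ
        {u | ENNReal.ofReal u ≤ (min tA tB : ℝ≥0)} ⊆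
      (Prod.mk Y ⁻¹' {r | assemble j y r ∈ selected pA q cA j ∩ selected pB q cB j} :
        Set ((ℝ × (Fin n → ℝ)) × ℝ)) := by
    rintro x ⟨⟨hs, hS⟩, hu⟩
    have hcA : candidate pA q (assemble j y (Y, x)).1 = j :=
      candidate_eq_of_lt hA j hyA hs fun l => lt_of_le_of_lt
        (mul_le_mul_of_nonneg_left (NNReal.coe_le_coe.2 (le_max_left _ _)) hs.le) (hS l)
    have hcB : candidate pB q (assemble j y (Y, x)).1 = j :=
      candidate_eq_of_lt hB j hyB hs fun l => lt_of_le_of_lt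
        (mul_le_mul_of_nonneg_left (NNReal.coe_le_coe.2 (le_max_right _ _)) hs.le) (hS l)
    refine ⟨⟨(accepts_assemble_iff hA j hcA).2 ?_, hcA⟩,
      ⟨(accepts_assemble_iff hB j hcB).2 ?_, hcB⟩⟩
    · have h1 := le_trans (Set.mem_ofPred_eq ▸ hu) (ENNReal.coe_le_coe.2 (min_le_left tA tB))
      rw [htA, coe_acceptProb hyA (weight_le hA y)] at h1
      exact h1
    · have h1 := le_trans (Set.mem_ofPred_eq ▸ hu) (ENNReal.coe_le_coe.2 (min_le_right tA tB))
      rw [htB, coe_acceptProb hyB (weight_le hB y)] at h1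
      exact h1
  refine le_trans ?_ (measure_mono hsub)
  have h1 : min tA tB ≤ 1 := (min_le_left _ _).trans (acceptProb_le_one (weight_le hA y) _)
  have h0 : (1 : ℝ≥0) + ∑ l, m l ≠ 0 := (add_pos_of_pos_of_nonneg one_pos zero_le).ne'
  rw [Measure.prod_prod, clockLaw_lt, unifLaw_le (by exact_mod_cast h1),
    ENNReal.coe_mul, ENNReal.coe_inv h0, ENNReal.coe_add, ENNReal.coe_one]

theorem le_othersLaw_selected (Q : Measure 𝒴) [IsProbabilityMeasure Q] (hp : Measurable p)
    (hq : Measurable q) (h : ∀ y, p y ≤ c * q y) (j : Fin (n + 1)) (y : 𝒴) :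
    weight p q y * ∫⁻ Y, (((totalWeight p q Y + c)⁻¹ : ℝ≥0) : ℝ≥0∞)
        ∂(Measure.pi fun _ : Fin n => Q) ≤
      othersLaw n Q {r | assemble j y r ∈ selected p q c j} := by
  rcases eq_zero_or_pos (weight p q y) with hy | hy
  · simp [hy]
  have := le_othersLaw_selected_inter Q hp hp hq h h j hy hy
  rw [Set.inter_self] at this
  refine le_trans ?_ this
  rw [← lintegral_const_mul' _ _ ENNReal.coe_ne_top]
  refine lintegral_mono fun Y => ?_
  rw [← ENNReal.coe_mul, ← race_mul_acceptProb hy, totalWeight, Finset.sum_div]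
  simp only [max_self, min_self, le_refl]

end Selection

/-! ### The bound on the probability that both parties select a proposal -/

section Density

variable {𝒴 : Type*} [MeasurableSpace 𝒴] {ν : Measure 𝒴} {p q : 𝒴 → ℝ≥0} {c : ℝ≥0}

theorem IsDensity.isProbabilityMeasure (hq : IsDensity ν q) :
    IsProbabilityMeasure (distOf ν q) :=
  ⟨by rw [distOf, withDensity_apply _ MeasurableSet.univ, setLIntegral_univ, hq.lintegral_eq_one]⟩

theorem lintegral_weight (hq : IsDensity ν q) (hp : IsDensity ν p) (h : ∀ y, p y ≤ c * q y) :
    ∫⁻ y, (weight p q y : ℝ≥0∞) ∂(distOf ν q) = 1 := by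
  rw [distOf, lintegral_withDensity_eq_lintegral_mul _ hq.measurable.coe_nnreal_ennreal
    (measurable_weight hp.measurable hq.measurable).coe_nnreal_ennreal, ← hp.lintegral_eq_one]
  refine lintegral_congr fun y => ?_
  rw [Pi.mul_apply, ← ENNReal.coe_mul, weight]
  rcases eq_or_ne (q y) 0 with h0 | h0
  · have : p y = 0 := le_antisymm (by simpa [h0] using h y) zero_le
    simp [h0, this]
  · rw [mul_div_cancel₀ _ h0]

theorem d2_eq_lintegral_inv_weight (hq : Measurable q) :
    d2 ν q p = ∫⁻ y, (weight p q y : ℝ≥0∞)⁻¹ ∂(distOf ν q) := by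
  refine lintegral_congr_ae ?_
  refine (ae_withDensity_iff hq.coe_nnreal_ennreal).2 (Eventually.of_forall fun y hy => ?_)
  have hy' : q y ≠ 0 := by exact_mod_cast hy
  change ratio q p y = ((p y / q y : ℝ≥0) : ℝ≥0∞)⁻¹
  rw [ENNReal.coe_div hy', ENNReal.inv_div (Or.inl ENNReal.coe_ne_top) (Or.inl hy), ratio]

end Density

section MatchBound

/-- The inverse lower bound for the conditional probability that both parties select the same
proposal, whose weights are `a` and `b`, in terms of the total weights `s`, `t` of the other
proposals. -/
def matchCost (cA cB a b s t : ℝ≥0) : ℝ≥0 :=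
  a⁻¹ * (s + cA) + b⁻¹ * (t + cB) + cA * b⁻¹ * (t * (a + s)⁻¹) + cB * a⁻¹ * (s * (b + t)⁻¹)

theorem matchCost_comm (cA cB a b s t : ℝ≥0) :
    matchCost cA cB a b s t = matchCost cB cA b a t s := by
  unfold matchCost; ring

theorem race_le_matchCost_mul {cA a b : ℝ≥0} (ha : 0 < a) (hc : a ≤ cA) (cB s t : ℝ≥0) :
    1 + s / a + t / b ≤ matchCost cA cB a b s t * acceptProb cA a s := by
  have h1 : 0 < a + s := add_pos_of_pos_of_nonneg ha zero_le
  have h2 : 0 < s + cA := add_pos_of_nonneg_of_pos zero_le (ha.trans_le hc)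
  calc 1 + s / a + t / b ≤ (a + s) / a + (a + s + cA) / (s + cA) * (t / b) := by
        rw [add_div, div_self ha.ne']
        gcongr
        refine le_mul_of_one_le_left zero_le ?_
        rw [one_le_div h2, add_assoc]
        exact le_add_self
    _ = (a⁻¹ * (s + cA) + b⁻¹ * t + cA * b⁻¹ * (t * (a + s)⁻¹)) * acceptProb cA a s := by
        unfold acceptProb
        have := h1.ne'
        have := h2.ne'
        rw [div_eq_mul_inv t b]
        field_simp
        ring
    _ ≤ (a⁻¹ * (s + cA) + b⁻¹ * (t + cB) + cA * b⁻¹ * (t * (a + s)⁻¹)) * acceptProb cA a s := by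
        gcongr
        exact le_self_add
    _ ≤ _ := by
        unfold matchCost
        gcongr ?_ * _
        exact le_self_add

/-- The right-hand side is a lower bound for the probability, given all proposals, that both parties
select a proposal of weights `a`, `b` competing with proposals of weights `u`, `v`. -/
theorem inv_matchCost_le {n : ℕ} {cA cB a b : ℝ≥0} (ha : 0 < a) (hcA : a ≤ cA) (hb : 0 < b)
    (hcB : b ≤ cB) (u v : Fin n → ℝ≥0) :
    (matchCost cA cB a b (∑ l, u l) (∑ l, v l))⁻¹ ≤ (1 + ∑ l, max (u l / a) (v l / b))⁻¹ *
      min (acceptProb cA a (∑ l, u l)) (acceptProb cB b (∑ l, v l)) := by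
  set s := ∑ l, u l
  set t := ∑ l, v l
  have hT : 1 + ∑ l, max (u l / a) (v l / b) ≤ 1 + s / a + t / b := by
    rw [Finset.sum_div, Finset.sum_div, add_assoc, ← Finset.sum_add_distrib]
    gcongr with l
    exact max_le le_self_add le_add_self
  have h0 : 0 < 1 + ∑ l, max (u l / a) (v l / b) := add_pos_of_pos_of_nonneg one_pos zero_le
  have hG : 0 < matchCost cA cB a b s t := by
    have : 0 < a⁻¹ * (s + cA) :=
      mul_pos (inv_pos.2 ha) (add_pos_of_nonneg_of_pos zero_le (ha.trans_le hcA))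
    unfold matchCost
    positivity
  rw [mul_comm _ (min _ _), ← div_eq_mul_inv, le_div_iff₀ h0, inv_mul_le_iff₀ hG, mul_min]
  refine hT.trans (le_min (race_le_matchCost_mul ha hcA cB s t) ?_)
  rw [matchCost_comm, add_right_comm]
  exact race_le_matchCost_mul hb hcB cA t s

variable {𝒴 : Type*} [MeasurableSpace 𝒴] {ν : Measure 𝒴} {q pA pB : 𝒴 → ℝ≥0} {ω cA cB : ℝ≥0}

theorem lintegral_matchCost_le (hq : IsDensity ν q) (hpA : IsDensity ν pA) (hpB : IsDensity ν pB)
    (hA : ∀ y, pA y ≤ cA * q y) (hB : ∀ y, pB y ≤ cB * q y) (hAω : cA ≤ ω) (hBω : cB ≤ ω)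
    {n : ℕ} (hn : 1 ≤ n) (a b : ℝ≥0) :
    ∫⁻ Y, (matchCost cA cB a b (totalWeight pA q Y) (totalWeight pB q Y) : ℝ≥0∞)
        ∂(Measure.pi fun _ : Fin n => distOf ν q) ≤
      ((a⁻¹ : ℝ≥0) : ℝ≥0∞) * (n + ω + ω * ind (n + 1) 2 ω * d2 ν q pB) +
      ((b⁻¹ : ℝ≥0) : ℝ≥0∞) * (n + ω + ω * ind (n + 1) 2 ω * d2 ν q pA) := by
  have := hq.isProbabilityMeasure
  set Q := distOf ν q with hQ
  have hwA := (measurable_weight hpA.measurable hq.measurable).coe_nnreal_ennreal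
  have hwB := (measurable_weight hpB.measurable hq.measurable).coe_nnreal_ennreal
  have hsum : ∀ {w : 𝒴 → ℝ≥0∞}, Measurable w → Measurable fun Y : Fin n → 𝒴 => ∑ l, w (Y l) :=
    fun hw => Finset.measurable_fun_sum _ fun l _ => hw.comp (measurable_pi_apply l)
  set α : ℝ≥0∞ := ((a⁻¹ : ℝ≥0) : ℝ≥0∞)
  set β : ℝ≥0∞ := ((b⁻¹ : ℝ≥0) : ℝ≥0∞)
  set sA : (Fin n → 𝒴) → ℝ≥0∞ := fun Y => ∑ l, (weight pA q (Y l) : ℝ≥0∞) with hsA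
  set sB : (Fin n → 𝒴) → ℝ≥0∞ := fun Y => ∑ l, (weight pB q (Y l) : ℝ≥0∞) with hsB
  have hmA : Measurable sA := hsum hwA
  have hmB : Measurable sB := hsum hwB
  have hdiv : ∀ x y z : ℝ≥0, ((x * (y + z)⁻¹ : ℝ≥0) : ℝ≥0∞) ≤ x * (z : ℝ≥0∞)⁻¹ := by
    intro x y z
    rw [ENNReal.coe_mul]
    gcongr
    refine ENNReal.coe_inv_le.trans (ENNReal.inv_le_inv.2 ?_)
    exact_mod_cast le_add_self
  have hpt : ∀ Y : Fin n → 𝒴,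
      (matchCost cA cB a b (totalWeight pA q Y) (totalWeight pB q Y) : ℝ≥0∞) ≤
      α * (sA Y + ω) + β * (sB Y + ω) + ω * β * (sB Y * (sA Y)⁻¹) +
        ω * α * (sA Y * (sB Y)⁻¹) := by
    intro Y
    have h1 := hdiv (totalWeight pB q Y) a (totalWeight pA q Y)
    have h2 := hdiv (totalWeight pA q Y) b (totalWeight pB q Y)
    have e1 : (totalWeight pA q Y : ℝ≥0∞) = sA Y := by simp [totalWeight, hsA]
    have e2 : (totalWeight pB q Y : ℝ≥0∞) = sB Y := by simp [totalWeight, hsB]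
    rw [e1, e2] at h1 h2
    unfold matchCost
    rw [ENNReal.coe_add, ENNReal.coe_add, ENNReal.coe_add, ENNReal.coe_mul, ENNReal.coe_mul,
      ENNReal.coe_mul (cA * b⁻¹), ENNReal.coe_mul (cB * a⁻¹), ENNReal.coe_mul cA,
      ENNReal.coe_mul cB, ENNReal.coe_add, ENNReal.coe_add, e1, e2]
    gcongr
  have hA1 : ∫⁻ Y, sA Y ∂(Measure.pi fun _ : Fin n => Q) = n := by
    rw [lintegral_pi_sum Q hwA, lintegral_weight hq hpA hA, mul_one]
  have hB1 : ∫⁻ Y, sB Y ∂(Measure.pi fun _ : Fin n => Q) = n := by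
    rw [lintegral_pi_sum Q hwB, lintegral_weight hq hpB hB, mul_one]
  have hBA : ∫⁻ Y, sB Y * (sA Y)⁻¹ ∂(Measure.pi fun _ : Fin n => Q) ≤
      ind (n + 1) 2 ω * d2 ν q pA := by
    rw [d2_eq_lintegral_inv_weight hq.measurable]
    exact lintegral_pi_sum_div_sum_le Q hn hwB hwA
      (fun y => by exact_mod_cast (weight_le hB y).trans hBω) (lintegral_weight hq hpB hB)
  have hAB : ∫⁻ Y, sA Y * (sB Y)⁻¹ ∂(Measure.pi fun _ : Fin n => Q) ≤
      ind (n + 1) 2 ω * d2 ν q pB := by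
    rw [d2_eq_lintegral_inv_weight hq.measurable]
    exact lintegral_pi_sum_div_sum_le Q hn hwA hwB
      (fun y => by exact_mod_cast (weight_le hA y).trans hAω) (lintegral_weight hq hpA hA)
  have hmBA : Measurable fun Y => sB Y * (sA Y)⁻¹ := hmB.mul hmA.inv
  have hmAB : Measurable fun Y => sA Y * (sB Y)⁻¹ := hmA.mul hmB.inv
  calc _ ≤ ∫⁻ Y, α * (sA Y + ω) + β * (sB Y + ω) + ω * β * (sB Y * (sA Y)⁻¹) +
        ω * α * (sA Y * (sB Y)⁻¹) ∂(Measure.pi fun _ : Fin n => Q) := lintegral_mono hpt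
    _ = α * (n + ω) + β * (n + ω) +
        ω * β * (∫⁻ Y, sB Y * (sA Y)⁻¹ ∂(Measure.pi fun _ : Fin n => Q)) +
        ω * α * (∫⁻ Y, sA Y * (sB Y)⁻¹ ∂(Measure.pi fun _ : Fin n => Q)) := by
        rw [lintegral_add_right _ (hmAB.const_mul _), lintegral_add_right _ (hmBA.const_mul _),
          lintegral_add_right _ ((hmB.add_const _).const_mul _),
          lintegral_const_mul _ hmAB, lintegral_const_mul _ hmBA,
          lintegral_const_mul _ (hmA.add_const _), lintegral_const_mul _ (hmB.add_const _),
          lintegral_add_right _ measurable_const, lintegral_add_right _ measurable_const,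
          hA1, hB1, lintegral_const, measure_univ, mul_one]
    _ ≤ α * (n + ω) + β * (n + ω) + ω * β * (ind (n + 1) 2 ω * d2 ν q pA) +
        ω * α * (ind (n + 1) 2 ω * d2 ν q pB) := by gcongr
    _ = _ := by ring

/-- Only the first term `ω + ω 𝕀 d` of the bracket in `coeff` is needed. -/
theorem add_mul_le_mul_coeff {n : ℕ} (d : ℝ≥0∞) :
    n + ω + ω * ind (n + 1) 2 ω * d ≤ ((n + 1 : ℕ) : ℝ≥0∞) * (1 + coeff ω d (n + 1)) := by
  have h0 : ((n + 1 : ℕ) : ℝ≥0∞) ≠ 0 := by exact_mod_cast n.succ_ne_zero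
  rw [coeff, mul_add, ← mul_assoc, one_div,
    ENNReal.mul_inv_cancel h0 (ENNReal.natCast_ne_top _), one_mul, mul_one, add_assoc]
  exact add_le_add (by exact_mod_cast n.le_succ) le_self_add

/-- Given that proposal `j` equals `y`, both parties select it with probability at least `1 / N`
times its encoder weight times the matching bound. -/
theorem le_othersLaw_of_matchBound (hq : IsDensity ν q) (hpA : IsDensity ν pA)
    (hpB : IsDensity ν pB)
    (hA : ∀ y, pA y ≤ cA * q y) (hB : ∀ y, pB y ≤ cB * q y) (hAω : cA ≤ ω) (hBω : cB ≤ ω)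
    {n : ℕ} (hn : 1 ≤ n) (j : Fin (n + 1)) (y : 𝒴) :
    ((n + 1 : ℕ) : ℝ≥0∞)⁻¹ * (weight pA q y * matchBound pA pB
        (coeff ω (d2 ν q pB) (n + 1)) (coeff ω (d2 ν q pA) (n + 1)) y) ≤
      othersLaw n (distOf ν q)
        {r | assemble j y r ∈ selected pA q cA j ∩ selected pB q cB j} := by
  have := hq.isProbabilityMeasure
  set a := weight pA q y with ha
  set b := weight pB q y with hb
  set μ₁ := coeff ω (d2 ν q pB) (n + 1) with hμ₁
  set μ₂ := coeff ω (d2 ν q pA) (n + 1) with hμ₂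
  rcases eq_zero_or_pos a with ha0 | ha0
  · simp [ha0]
  have hpA0 : pA y ≠ 0 := fun h => ha0.ne' (by rw [ha, weight, h, zero_div])
  have hq0 : q y ≠ 0 := fun h => ha0.ne' (by rw [ha, weight, h, div_zero])
  rcases eq_zero_or_pos b with hb0 | hb0
  · -- the bracket in `matchBound` is infinite here
    have hpB0 : pB y = 0 := by
      rw [hb, weight, div_eq_zero_iff] at hb0
      exact hb0.resolve_right hq0
    have : ratio pA pB y = ∞ := by
      rw [ratio, hpB0, ENNReal.coe_zero, ENNReal.div_zero (by exact_mod_cast hpA0)]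
    have h2 : matchBound pA pB μ₁ μ₂ y = 0 := by
      rw [matchBound, this, ENNReal.top_mul (by simp), add_top, ENNReal.inv_top]
    simp [h2]
  have hpB0 : pB y ≠ 0 := fun h => hb0.ne' (by rw [hb, weight, h, zero_div])
  have hratio : ratio pA pB y = ((a * b⁻¹ : ℝ≥0) : ℝ≥0∞) := by
    rw [ratio, ← ENNReal.coe_div hpB0, ha, hb, weight, weight]
    congr 1
    field_simp
  refine le_trans ?_ (le_othersLaw_selected_inter (distOf ν q) hpA.measurable hpB.measurable
    hq.measurable hA hB j ha0 hb0)
  have hM : Measurable fun Y : Fin n → 𝒴 =>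
      (matchCost cA cB a b (totalWeight pA q Y) (totalWeight pB q Y) : ℝ≥0∞) := by
    have h1 := measurable_totalWeight (n := n) hpA.measurable hq.measurable
    have h2 := measurable_totalWeight (n := n) hpB.measurable hq.measurable
    unfold matchCost
    fun_prop
  calc _ ≤ (∫⁻ Y, (matchCost cA cB a b (totalWeight pA q Y) (totalWeight pB q Y) : ℝ≥0∞)
        ∂(Measure.pi fun _ : Fin n => distOf ν q))⁻¹ := ?_
    _ ≤ ∫⁻ Y, (matchCost cA cB a b (totalWeight pA q Y) (totalWeight pB q Y) : ℝ≥0∞)⁻¹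
        ∂(Measure.pi fun _ : Fin n => distOf ν q) := inv_lintegral_le_lintegral_inv _ hM
    _ ≤ _ := by
        refine lintegral_mono fun Y => ?_
        have hle := inv_matchCost_le ha0 (weight_le hA y) hb0 (weight_le hB y)
          (fun l => weight pA q (Y l)) (fun l => weight pB q (Y l))
        have hne : matchCost cA cB a b (totalWeight pA q Y) (totalWeight pB q Y) ≠ 0 := by
          intro h
          simp only [matchCost, add_eq_zero, mul_eq_zero, inv_eq_zero] at h
          rcases h.1.1.1 with h | h
          · exact ha0.ne' h
          · exact (ha0.trans_le (weight_le hA y)).ne' h.2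
        rw [← ENNReal.coe_inv hne]
        exact ENNReal.coe_le_coe.2 hle
  have hlow := (lintegral_matchCost_le hq hpA hpB hA hB hAω hBω hn a b).trans
    (add_le_add (mul_le_mul_right (add_mul_le_mul_coeff _) _)
      (mul_le_mul_right (add_mul_le_mul_coeff _) _))
  refine le_trans (le_of_eq ?_) (ENNReal.inv_le_inv.2 hlow)
  have hN0 : ((n + 1 : ℕ) : ℝ≥0∞) ≠ 0 := by exact_mod_cast n.succ_ne_zero
  have ha0' : (a : ℝ≥0∞) ≠ 0 := by exact_mod_cast ha0.ne'
  have hcancel : (a : ℝ≥0∞) * ((a⁻¹ : ℝ≥0) : ℝ≥0∞) = 1 := by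
    rw [← ENNReal.coe_mul, mul_inv_cancel₀ ha0.ne', ENNReal.coe_one]
  have hβ : ((b⁻¹ : ℝ≥0) : ℝ≥0∞) =
      ((a⁻¹ : ℝ≥0) : ℝ≥0∞) * ((a * b⁻¹ : ℝ≥0) : ℝ≥0∞) := by
    rw [← ENNReal.coe_mul, ← mul_assoc, inv_mul_cancel₀ ha0.ne', one_mul]
  have hfac : ((a⁻¹ : ℝ≥0) : ℝ≥0∞) * (((n + 1 : ℕ) : ℝ≥0∞) * (1 + μ₁)) +
      ((b⁻¹ : ℝ≥0) : ℝ≥0∞) * (((n + 1 : ℕ) : ℝ≥0∞) * (1 + μ₂)) =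
      ((n + 1 : ℕ) : ℝ≥0∞) * (((a⁻¹ : ℝ≥0) : ℝ≥0∞) *
        (1 + μ₁ + ratio pA pB y * (1 + μ₂))) := by
    rw [hβ, hratio]
    ring
  rw [hfac, ENNReal.mul_inv (Or.inl hN0) (Or.inl (ENNReal.natCast_ne_top _)),
    ENNReal.mul_inv (Or.inl (by simpa using ha0.ne'))
      (Or.inl ENNReal.coe_ne_top), ENNReal.coe_inv ha0.ne', inv_inv, matchBound]

end MatchBound

/-! ### The law of the output -/

section FirstHit

variable {β : Type*} [MeasurableSpace β] (μ : Measure β) [IsProbabilityMeasure μ]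
  {A F : Set β}

theorem infinitePi_forall_lt_notMem (hA : MeasurableSet A) (hF : MeasurableSet F) (i : ℕ) :
    Measure.infinitePi (fun _ : ℕ => μ) {w | (∀ k < i, w k ∉ A) ∧ w i ∈ F} =
      (1 - μ A) ^ i * μ F := by
  have hset : {w : ℕ → β | (∀ k < i, w k ∉ A) ∧ w i ∈ F} =
      Set.pi (Finset.range (i + 1)) fun k => if k < i then Aᶜ else F := by
    ext w
    simp only [Set.mem_ofPred_eq, Set.mem_pi, Finset.coe_range, Set.mem_Iio]
    constructor
    · rintro ⟨h1, h2⟩ k hk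
      rcases (Nat.lt_succ_iff.1 hk).lt_or_eq with h | rfl
      · rw [if_pos h]; exact h1 k h
      · rw [if_neg (lt_irrefl _)]; exact h2
    · intro h
      refine ⟨fun k hk => ?_, ?_⟩
      · have := h k (by omega)
        rwa [if_pos hk] at this
      · have := h i (by omega)
        rwa [if_neg (lt_irrefl _)] at this
  rw [hset, Measure.infinitePi_pi]
  · rw [Finset.prod_range_succ, if_neg (lt_irrefl _)]
    congr 1
    rw [Finset.prod_congr rfl (g := fun _ => 1 - μ A), Finset.prod_const, Finset.card_range]
    intro k hk
    rw [if_pos (Finset.mem_range.1 hk), prob_compl_eq_one_sub hA]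
  · intro k _
    split_ifs
    exacts [hA.compl, hF]

theorem infinitePi_forall_notMem (hA : MeasurableSet A) (h0 : μ A ≠ 0) :
    Measure.infinitePi (fun _ : ℕ => μ) {w | ∀ i, w i ∉ A} = 0 := by
  have hlt : 1 - μ A < 1 := ENNReal.sub_lt_self ENNReal.one_ne_top one_ne_zero h0
  refine le_antisymm (ge_of_tendsto' (ENNReal.tendsto_pow_atTop_nhds_zero_of_lt_one hlt)
    fun i => ?_) zero_le
  have := infinitePi_forall_lt_notMem μ hA MeasurableSet.univ i
  rw [measure_univ, mul_one] at this
  rw [← this]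
  exact measure_mono fun w hw => ⟨fun k _ => hw k, trivial⟩

/-- The first entry of an i.i.d. sequence that lies in `A` has law at most `μ(· ∣ A)`. -/
theorem infinitePi_exists_first_mem_le (hA : MeasurableSet A) (hF : MeasurableSet F) :
    Measure.infinitePi (fun _ : ℕ => μ) {w | ∃ i, (∀ k < i, w k ∉ A) ∧ w i ∈ F} ≤
      (μ A)⁻¹ * μ F := by
  have hset : {w : ℕ → β | ∃ i, (∀ k < i, w k ∉ A) ∧ w i ∈ F} =
      ⋃ i, {w | (∀ k < i, w k ∉ A) ∧ w i ∈ F} := by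
    ext w; simp
  rw [hset]
  refine (measure_iUnion_le _).trans (le_of_eq ?_)
  simp_rw [infinitePi_forall_lt_notMem μ hA hF]
  rw [ENNReal.tsum_mul_right, ENNReal.tsum_geometric,
    ENNReal.sub_sub_cancel ENNReal.one_ne_top prob_le_one]

end FirstHit

section OutputLaw

variable {𝒴 : Type*} [MeasurableSpace 𝒴] {ν : Measure 𝒴} {p q : 𝒴 → ℝ≥0} {c : ℝ≥0} {n : ℕ}

/-- The law of the selected proposal, disintegrated along its value. -/
theorem batchLaw_selected_inter (Q : Measure 𝒴) [IsProbabilityMeasure Q]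
    (hp : Measurable p) (hq : Measurable q) (j : Fin (n + 1)) {E : Set 𝒴} (hE : MeasurableSet E) :
    batchLaw (n + 1) Q (selected p q c j ∩ {a | (a.1 j).1 ∈ E}) =
      ∫⁻ y in E, othersLaw n Q {r | assemble j y r ∈ selected p q c j} ∂Q := by
  classical
  have hs := measurableSet_selected (c := c) hp hq j
  have hE' : MeasurableSet {a : (Fin (n + 1) → 𝒴 × ℝ) × ℝ | (a.1 j).1 ∈ E} :=
    (((measurable_pi_apply j).comp measurable_fst).fst) hE
  rw [← lintegral_indicator_one (hs.inter hE'),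
    lintegral_batchLaw Q j (measurable_one.indicator (hs.inter hE')),
    ← lintegral_indicator hE]
  refine lintegral_congr fun y => ?_
  have hm : MeasurableSet {r | assemble j y r ∈ selected p q c j} :=
    (measurable_assemble j).comp measurable_prodMk_left hs
  by_cases hy : y ∈ E
  · rw [Set.indicator_of_mem hy, ← lintegral_indicator_one hm]
    refine lintegral_congr fun r => ?_
    simp only [Set.indicator_apply, Set.mem_inter_iff, Set.mem_ofPred_eq, assemble_fst_apply_fst,
      hy, and_true, Pi.one_apply]
  · rw [Set.indicator_of_notMem hy, ← lintegral_zero (μ := othersLaw n Q)]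
    refine lintegral_congr fun r => ?_
    simp only [Set.indicator_apply, Set.mem_inter_iff, Set.mem_ofPred_eq, assemble_fst_apply_fst,
      hy, and_false, if_false]

/-- Ensemble Rejection Sampling does not exceed its target: the law of the output is at most the
law with density `p`. (Both being probability measures, they agree.) -/
theorem map_output_le (hq : IsDensity ν q) (hp : IsDensity ν p) (h : ∀ y, p y ≤ c * q y) :
    (randomnessLaw (n + 1) (distOf ν q)).map (output p q c) ≤
      (distOf ν q).withDensity fun y => weight p q y := by
  have := hq.isProbabilityMeasure
  set Q := distOf ν q with hQ
  have hp' : Measurable (Function.uncurry fun _ : Unit => p) := hp.measurable.comp measurable_snd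
  have hout : Measurable (output p q c : Randomness (n + 1) 𝒴 → 𝒴) :=
    measurable_output (c := fun _ : Unit => c) (f := fun _ : Randomness (n + 1) 𝒴 => ()) hp'
      hq.measurable measurable_const measurable_const measurable_id
  have hsel := fun j : Fin (n + 1) => measurableSet_selected (c := c) hp.measurable hq.measurable j
  set A : Set ((Fin (n + 1) → 𝒴 × ℝ) × ℝ) := ⋃ j, selected p q c j with hA
  have hAmem : ∀ a, a ∈ A ↔ Accepts p q c a := fun a => by simp [hA, selected]
  have hAm : MeasurableSet A := MeasurableSet.iUnion hsel
  set I : ℝ≥0∞ := ∫⁻ Y, (((totalWeight p q Y + c)⁻¹ : ℝ≥0) : ℝ≥0∞)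
        ∂(Measure.pi fun _ : Fin n => Q) with hI
  -- `c = 0` would make the inverse in `I` a junk value
  have hc : c ≠ 0 := by
    rintro rfl
    have h1 := lintegral_weight hq hp h
    have h2 : ∀ y, (weight p q y : ℝ≥0∞) = 0 := fun y => by
      have := weight_le h y
      simpa using this
    simp [h2] at h1
  have hI0 : I ≠ 0 := by
    have hm : Measurable fun Y : Fin n → 𝒴 => (((totalWeight p q Y + c)⁻¹ : ℝ≥0) : ℝ≥0∞) :=
      ((measurable_totalWeight hp.measurable hq.measurable).add_const c).inv.coe_nnreal_ennreal
    intro h0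
    rw [hI, lintegral_eq_zero_iff hm] at h0
    obtain ⟨Y, hY⟩ := h0.exists
    simp [hc] at hY
  have hAlow : (n + 1 : ℕ) * I ≤ batchLaw (n + 1) Q A := by
    have hdisj : Pairwise (Function.onFun Disjoint
        (selected p q c : Fin (n + 1) → Set ((Fin (n + 1) → 𝒴 × ℝ) × ℝ))) :=
      fun i j hij => Set.disjoint_left.2 fun a hi hj => hij (hi.2.symm.trans hj.2)
    rw [hA, measure_iUnion hdisj hsel, tsum_fintype]
    calc _ = ∑ _j : Fin (n + 1), I := by simp
      _ ≤ _ := Finset.sum_le_sum fun j _ => ?_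
    have hj := batchLaw_selected_inter (c := c) Q hp.measurable hq.measurable j MeasurableSet.univ
    simp only [Set.mem_univ, Set.ofPred_true, Set.inter_univ, setLIntegral_univ] at hj
    rw [hj]
    calc I = ∫⁻ y, weight p q y * I ∂Q := by
          rw [lintegral_mul_const _
            (measurable_weight hp.measurable hq.measurable).coe_nnreal_ennreal,
            lintegral_weight hq hp h, one_mul]
      _ ≤ _ := lintegral_mono fun y =>
          le_othersLaw_selected Q hp.measurable hq.measurable h j y
  have hN0 : ((n + 1 : ℕ) : ℝ≥0∞) ≠ 0 := by exact_mod_cast n.succ_ne_zero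
  have hC0 : (n + 1 : ℕ) * I ≠ 0 := mul_ne_zero hN0 hI0
  have hCt : (n + 1 : ℕ) * I ≠ ∞ := ne_top_of_le_ne_top ENNReal.one_ne_top (hAlow.trans prob_le_one)
  have hA0 : batchLaw (n + 1) Q A ≠ 0 := fun h0 => hC0 (le_antisymm (h0 ▸ hAlow) zero_le)
  refine Measure.le_iff.2 fun E hE => ?_
  rw [Measure.map_apply hout hE, withDensity_apply _ hE]
  set F : Set ((Fin (n + 1) → 𝒴 × ℝ) × ℝ) :=
    ⋃ j, selected p q c j ∩ {a | (a.1 j).1 ∈ E} with hF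
  have hFm : MeasurableSet F := MeasurableSet.iUnion fun j => (hsel j).inter
    ((((measurable_pi_apply j).comp measurable_fst).fst) hE)
  have hFle : batchLaw (n + 1) Q F ≤ (n + 1 : ℕ) * I * ∫⁻ y in E, weight p q y ∂Q := by
    refine (measure_iUnion_le _).trans ?_
    rw [tsum_fintype]
    calc _ ≤ ∑ _j : Fin (n + 1), I * ∫⁻ y in E, weight p q y ∂Q :=
          Finset.sum_le_sum fun j _ => ?_
      _ = _ := by simp [mul_assoc]
    rw [batchLaw_selected_inter Q hp.measurable hq.measurable j hE, mul_comm,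
      ← lintegral_mul_const _ (measurable_weight hp.measurable hq.measurable).coe_nnreal_ennreal]
    exact lintegral_mono fun y => othersLaw_selected_le Q hp.measurable hq.measurable h j y
  have hcover : output p q c ⁻¹' E ⊆
      {w : Randomness (n + 1) 𝒴 | ∃ i, (∀ k < i, w k ∉ A) ∧ w i ∈ F} ∪ {w | ∀ i, w i ∉ A} := by
    intro w hw
    by_cases hex : ∃ i, w i ∈ A
    · left
      have hne : {i | Accepts p q c (w i)}.Nonempty := hex.imp fun i hi => (hAmem _).1 hi
      refine ⟨batchIndex p q c w, fun k hk hkA => ?_, ?_⟩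
      · exact Nat.notMem_of_lt_sInf hk ((hAmem _).1 hkA)
      · exact Set.mem_iUnion.2 ⟨_, ⟨Nat.sInf_mem hne, rfl⟩, hw⟩
    · right
      exact fun i hi => hex ⟨i, hi⟩
  calc _ ≤ _ := (measure_mono hcover).trans (measure_union_le _ _)
    _ ≤ (batchLaw (n + 1) Q A)⁻¹ * batchLaw (n + 1) Q F + 0 :=
        add_le_add (infinitePi_exists_first_mem_le (batchLaw (n + 1) Q) hAm hFm)
          (infinitePi_forall_notMem (batchLaw (n + 1) Q) hAm hA0).le
    _ ≤ ((n + 1 : ℕ) * I)⁻¹ * ((n + 1 : ℕ) * I * ∫⁻ y in E, weight p q y ∂Q) := by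
        rw [add_zero]
        gcongr
    _ = _ := by rw [← mul_assoc, ENNReal.inv_mul_cancel hC0 hCt, one_mul]

theorem lintegral_output_le (hq : IsDensity ν q) (hp : IsDensity ν p) (h : ∀ y, p y ≤ c * q y)
    {g : 𝒴 → ℝ≥0∞} (hg : Measurable g) :
    ∫⁻ w, g (output p q c w) ∂(randomnessLaw (n + 1) (distOf ν q)) ≤
      ∫⁻ y, weight p q y * g y ∂(distOf ν q) := by
  have hp' : Measurable (Function.uncurry fun _ : Unit => p) := hp.measurable.comp measurable_snd
  have hout : Measurable (output p q c : Randomness (n + 1) 𝒴 → 𝒴) :=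
    measurable_output (c := fun _ : Unit => c) (f := fun _ : Randomness (n + 1) 𝒴 => ()) hp'
      hq.measurable measurable_const measurable_const measurable_id
  rw [← lintegral_map hg hout]
  refine (lintegral_mono' (map_output_le hq hp h) le_rfl).trans (le_of_eq ?_)
  exact lintegral_withDensity_eq_lintegral_mul _
    (measurable_weight hp.measurable hq.measurable).coe_nnreal_ennreal hg

end OutputLaw

/-! ### The matching inequality for a fixed source value -/

theorem matchBound_le_one {𝒴 : Type*} (pA pB : 𝒴 → ℝ≥0) (μ₁ μ₂ : ℝ≥0∞) (y : 𝒴) :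
    matchBound pA pB μ₁ μ₂ y ≤ 1 := by
  rw [matchBound, ENNReal.inv_le_one, add_assoc]
  exact le_self_add

theorem output_eq_of_mem_selected {𝒴 : Type*} {N : ℕ} [NeZero N] {p q : 𝒴 → ℝ≥0} {c : ℝ≥0}
    {j : Fin N}
    {w : Randomness N 𝒴} (hw : w 0 ∈ selected p q c j) : output p q c w = ((w 0).1 j).1 := by
  have h0 : batchIndex p q c w = 0 := Nat.sInf_eq_zero.2 (Or.inl hw.1)
  rw [output, localIndex, h0, hw.2]

section Disintegration

variable {α β 𝒳 𝒴 𝒵 : Type*} [MeasurableSpace α] [MeasurableSpace β] [MeasurableSpace 𝒳]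
  [MeasurableSpace 𝒴] [MeasurableSpace 𝒵] {ν : Measure 𝒴} {q : 𝒴 → ℝ≥0}

theorem IsCondDensity.isDensity {p : α → 𝒴 → ℝ≥0} (hp : IsCondDensity ν p) (a : α) :
    IsDensity ν (p a) :=
  ⟨hp.measurable.comp measurable_prodMk_left, hp.lintegral_eq_one a⟩

theorem measurable_d2 (hq : IsDensity ν q) {p : α → 𝒴 → ℝ≥0} (hp : IsCondDensity ν p) :
    Measurable fun a => d2 ν q (p a) := by
  have := hq.isProbabilityMeasure
  refine Measurable.lintegral_prod_right' (ν := distOf ν q)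
    (f := fun x : α × 𝒴 => ratio q (p x.1) x.2) ?_
  exact (hq.measurable.comp measurable_snd).coe_nnreal_ennreal.div
    hp.measurable.coe_nnreal_ennreal

theorem measurable_coeff (ω : ℝ≥0) (N : ℕ) : Measurable fun d => coeff ω d N := by
  unfold coeff
  fun_prop

theorem measurable_matchBound {pA : 𝒳 → 𝒴 → ℝ≥0} {pB : 𝒵 → 𝒴 → ℝ≥0}
    (hq : IsDensity ν q) (hpA : IsCondDensity ν pA) (hpB : IsCondDensity ν pB) (ω : ℝ≥0) (N : ℕ)
    {f : β → 𝒳} {g : β → 𝒴} {h : β → 𝒵} (hf : Measurable f) (hg : Measurable g)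
    (hh : Measurable h) :
    Measurable fun b => matchBound (pA (f b)) (pB (h b)) (coeff ω (d2 ν q (pB (h b))) N)
      (coeff ω (d2 ν q (pA (f b))) N) (g b) := by
  unfold matchBound ratio
  have h1 := (measurable_coeff ω N).comp ((measurable_d2 hq hpB).comp hh)
  have h2 := (measurable_coeff ω N).comp ((measurable_d2 hq hpA).comp hf)
  have h3 := (hpA.measurable.comp (hf.prodMk hg)).coe_nnreal_ennreal
  have h4 := (hpB.measurable.comp (hh.prodMk hg)).coe_nnreal_ennreal
  exact ((h1.const_add 1).add ((h3.div h4).mul (h2.const_add 1))).inv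

/-- The matching inequality for a fixed value of the source, integrated against the conditional law
`κ` of the decoder's observation given the encoder's output. The output of the encoder is
distributed with density `pA`, and outputs agree whenever both parties select the same proposal of
the first batch; conditioning on that proposal turns this into the pointwise bound
`le_othersLaw_of_matchBound`. -/
theorem lintegral_matchBound_le {pA : 𝒴 → ℝ≥0} {pB : 𝒵 → 𝒴 → ℝ≥0} {cA ω : ℝ≥0} {cB : 𝒵 → ℝ≥0}
    (hq : IsDensity ν q) (hpA : IsDensity ν pA) (hpB : IsCondDensity ν pB) (hcB : Measurable cB)
    (hA : ∀ y, pA y ≤ cA * q y) (hB : ∀ z y, pB z y ≤ cB z * q y) (hAω : cA ≤ ω)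
    (hBω : ∀ z, cB z ≤ ω) {n : ℕ} (hn : 1 ≤ n) (κ : Kernel 𝒴 𝒵) [IsMarkovKernel κ]
    {D : Set (𝒴 × 𝒵)} (hD : MeasurableSet D) :
    ∫⁻ w, ∫⁻ z, D.indicator (fun x => matchBound pA (pB x.2) (coeff ω (d2 ν q (pB x.2)) (n + 1))
        (coeff ω (d2 ν q pA) (n + 1)) x.1) (output pA q cA w, z) ∂(κ (output pA q cA w))
        ∂(randomnessLaw (n + 1) (distOf ν q)) ≤
      ∫⁻ w, ∫⁻ z, {x | (output pA q cA w, x) ∈ D ∧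
        output pA q cA w = output (pB x) q (cB x) w}.indicator 1 z ∂(κ (output pA q cA w))
        ∂(randomnessLaw (n + 1) (distOf ν q)) := by
  classical
  have := hq.isProbabilityMeasure
  set Q := distOf ν q with hQ
  set bd : 𝒴 × 𝒵 → ℝ≥0∞ := D.indicator fun x =>
    matchBound pA (pB x.2) (coeff ω (d2 ν q (pB x.2)) (n + 1))
      (coeff ω (d2 ν q pA) (n + 1)) x.1 with hbd
  have hbdm : Measurable bd := by
    have hpA' : IsCondDensity ν fun _ : Unit => pA :=
      ⟨hpA.measurable.comp measurable_snd, fun _ => hpA.lintegral_eq_one⟩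
    exact (measurable_matchBound hq hpA' hpB ω (n + 1) (f := fun _ : 𝒴 × 𝒵 => ())
      measurable_const measurable_fst measurable_snd).indicator hD
  have hwA := (measurable_weight hpA.measurable hq.measurable).coe_nnreal_ennreal
  -- both parties select proposal `j`, and `(Y j, z) ∈ D`
  set G : Fin (n + 1) → Set (((Fin (n + 1) → 𝒴 × ℝ) × ℝ) × 𝒵) := fun j =>
    {x | (x.1 ∈ selected pA q cA j ∩ selected (pB x.2) q (cB x.2) j) ∧ ((x.1.1 j).1, x.2) ∈ D}
    with hG
  have hyj : ∀ j : Fin (n + 1),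
      Measurable fun a : (Fin (n + 1) → 𝒴 × ℝ) × ℝ => (a.1 j).1 := fun j =>
    ((measurable_pi_apply j).comp measurable_fst).fst
  have hGm : ∀ j, MeasurableSet (G j) := fun j => by
    have h1 : MeasurableSet {x : ((Fin (n + 1) → 𝒴 × ℝ) × ℝ) × 𝒵 | x.1 ∈ selected pA q cA j} :=
      measurable_fst (measurableSet_selected hpA.measurable hq.measurable j)
    have h2 : MeasurableSet {x : ((Fin (n + 1) → 𝒴 × ℝ) × ℝ) × 𝒵 |
        x.1 ∈ selected (pB x.2) q (cB x.2) j} :=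
      (measurableSet_accepts hpB.measurable hq.measurable hcB measurable_snd
        measurable_fst).inter
        (measurable_candidate hpB.measurable hq.measurable measurable_snd measurable_fst.fst
          (measurableSet_singleton j))
    exact (h1.inter h2).inter ((((hyj j).comp measurable_fst).prodMk measurable_snd) hD)
  set φ : Fin (n + 1) → ((Fin (n + 1) → 𝒴 × ℝ) × ℝ) → ℝ≥0∞ := fun j a =>
    ∫⁻ z, (G j).indicator 1 (a, z) ∂(κ (a.1 j).1) with hφ
  have hφm : ∀ j, Measurable (φ j) := fun j => by
    have := Measurable.lintegral_kernel_prod_right' (κ := κ.comap _ (hyj j))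
      (measurable_one.indicator (hGm j) : Measurable ((G j).indicator
        (1 : ((Fin (n + 1) → 𝒴 × ℝ) × ℝ) × 𝒵 → ℝ≥0∞)))
    simpa only [Kernel.comap_apply] using this
  have heval := measurePreserving_eval_infinitePi (fun _ : ℕ => batchLaw (n + 1) Q) 0
  have hlow : ∀ j, ∫⁻ y, ((n + 1 : ℕ) : ℝ≥0∞)⁻¹ *
      (weight pA q y * ∫⁻ z, bd (y, z) ∂(κ y)) ∂Q ≤ ∫⁻ a, φ j a ∂(batchLaw (n + 1) Q) := by
    intro j
    rw [lintegral_batchLaw Q j (hφm j)]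
    refine lintegral_mono fun y => ?_
    have hGy : Measurable fun x : ((Fin n → 𝒴) × (ℝ × (Fin n → ℝ)) × ℝ) × 𝒵 =>
        (G j).indicator (1 : ((Fin (n + 1) → 𝒴 × ℝ) × ℝ) × 𝒵 → ℝ≥0∞) (assemble j y x.1, x.2) :=
      (measurable_one.indicator (hGm j)).comp
        (((measurable_assemble j).comp (measurable_const.prodMk measurable_fst)).prodMk
          measurable_snd)
    calc _ = ∫⁻ z, ((n + 1 : ℕ) : ℝ≥0∞)⁻¹ * (weight pA q y * bd (y, z)) ∂(κ y) := by
          have hb : Measurable fun z => bd (y, z) := hbdm.comp measurable_prodMk_left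
          rw [lintegral_const_mul _ (hb.const_mul _), lintegral_const_mul _ hb]
      _ ≤ ∫⁻ z, ∫⁻ r, (G j).indicator 1 (assemble j y r, z) ∂(othersLaw n Q) ∂(κ y) := by
          refine lintegral_mono fun z => ?_
          by_cases hz : (y, z) ∈ D
          · have hm : MeasurableSet {r | assemble j y r ∈
                selected pA q cA j ∩ selected (pB z) q (cB z) j} :=
              (measurable_assemble j).comp measurable_prodMk_left
                ((measurableSet_selected hpA.measurable hq.measurable j).inter
                  (measurableSet_selected (hpB.isDensity z).measurable hq.measurable j))
            refine ((le_of_eq ?_).trans (le_othersLaw_of_matchBound hq hpA (hpB.isDensity z) hA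
              (hB z) hAω (hBω z) hn j y)).trans (le_of_eq ?_)
            · simp only [hbd, Set.indicator_of_mem hz]
            · rw [← lintegral_indicator_one hm]
              refine lintegral_congr fun r => ?_
              simp only [hG, Set.indicator_apply, Set.mem_ofPred_eq, assemble_fst_apply_fst, hz,
                and_true, Pi.one_apply]
          · simp [hbd, Set.indicator_of_notMem hz]
      _ = ∫⁻ r, ∫⁻ z, (G j).indicator 1 (assemble j y r, z) ∂(κ y) ∂(othersLaw n Q) :=
          (lintegral_lintegral_swap hGy.aemeasurable).symm
      _ = _ := by simp only [hφ, assemble_fst_apply_fst]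
  have hκm : Measurable fun y => ∫⁻ z, bd (y, z) ∂(κ y) := hbdm.lintegral_kernel_prod_right'
  have hwκm : Measurable fun y => weight pA q y * ∫⁻ z, bd (y, z) ∂(κ y) := hwA.mul hκm
  calc _ ≤ ∫⁻ y, weight pA q y * ∫⁻ z, bd (y, z) ∂(κ y) ∂Q :=
        lintegral_output_le hq hpA hA hκm
    _ = ∑ _j : Fin (n + 1), ∫⁻ y, ((n + 1 : ℕ) : ℝ≥0∞)⁻¹ *
      (weight pA q y * ∫⁻ z, bd (y, z) ∂(κ y)) ∂Q := by
        rw [Finset.sum_const, Finset.card_univ, Fintype.card_fin, nsmul_eq_mul,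
          lintegral_const_mul _ hwκm, ← mul_assoc,
          ENNReal.mul_inv_cancel (by exact_mod_cast n.succ_ne_zero) (ENNReal.natCast_ne_top _),
          one_mul]
    _ ≤ ∑ j, ∫⁻ a, φ j a ∂(batchLaw (n + 1) Q) := Finset.sum_le_sum fun j _ => hlow j
    _ = ∫⁻ w, ∑ j, φ j (w 0) ∂(randomnessLaw (n + 1) Q) := by
        have hm : ∀ j, Measurable fun w : Randomness (n + 1) 𝒴 => φ j (w 0) := fun j =>
          (hφm j).comp (measurable_pi_apply 0)
        rw [lintegral_finsetSum _ fun j _ => hm j]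
        exact Finset.sum_congr rfl fun j _ => (heval.lintegral_comp (hφm j)).symm
    _ ≤ _ := by
        refine lintegral_mono fun w => ?_
        by_cases hw : ∃ j, w 0 ∈ selected pA q cA j
        · obtain ⟨j, hj⟩ := hw
          have hne : ∀ i, i ≠ j → φ i (w 0) = 0 := by
            intro i hi
            have : ∀ z, (w 0, z) ∉ G i := fun z hz => hi (hz.1.1.2.symm.trans hj.2)
            simp [hφ, this]
          rw [Finset.sum_eq_single j (fun i _ hi => hne i hi) (by simp)]
          simp only [hφ, output_eq_of_mem_selected hj]
          refine lintegral_mono fun z => ?_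
          by_cases hz : (w 0, z) ∈ G j
          · have hmem : z ∈ {x | (((w 0).1 j).1, x) ∈ D ∧
                ((w 0).1 j).1 = output (pB x) q (cB x) w} :=
              ⟨hz.2, (output_eq_of_mem_selected hz.1.2).symm⟩
            rw [Set.indicator_of_mem hz, Set.indicator_of_mem hmem]
            rfl
          · simp [hz]
        · push Not at hw
          have : ∀ i z, (w 0, z) ∉ G i := fun i z hz => hw i hz.1.1
          simp [hφ, this]

end Disintegration

/-! ### Asymptotics of the coefficients and lower bounds on conditional probabilities -/

section Asymptotic

/-- For `n ≥ 3` the indicator in `coeff` equals `2`, and the coefficient lies between two multiples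
of `1 / n`. -/
theorem coeff_bounds (ω : ℝ≥0) (d : ℝ≥0∞) {n : ℕ} (hn : 3 ≤ n) :
    (n : ℝ≥0∞)⁻¹ * ω ≤ coeff ω d n ∧
      coeff ω d n ≤ (n : ℝ≥0∞)⁻¹ * (ω + ω * 2 * d + (ω : ℝ≥0∞) ^ 2 * d) := by
  have hind : ind n 2 ω = 2 := by
    simp [ind, show 2 < n by omega, show n ≠ 2 by omega]
  rw [coeff, hind, one_div]
  refine ⟨?_, ?_⟩
  · gcongr
    exact le_add_right le_self_add
  · gcongr
    refine ENNReal.div_le_of_le_mul (le_mul_of_one_le_right zero_le ?_)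
    have : ((n : ℝ≥0∞) - 1) = ((n - 1 : ℕ) : ℝ≥0∞) := by simp
    rw [this]
    exact_mod_cast (by omega : 1 ≤ n - 1)

theorem tendsto_coeff (ω : ℝ≥0) {d : ℝ≥0∞} (hd : d ≠ ∞) :
    Tendsto (fun n : ℕ => coeff ω d n) atTop (𝓝 0) := by
  set C : ℝ≥0∞ := ω + ω * 2 * d + (ω : ℝ≥0∞) ^ 2 * d with hC
  have hCt : C ≠ ∞ := by finiteness
  have hlim : Tendsto (fun n : ℕ => (n : ℝ≥0∞)⁻¹ * C) atTop (𝓝 0) := by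
    simpa using ENNReal.Tendsto.mul_const ENNReal.tendsto_inv_nat_nhds_zero (Or.inr hCt)
  exact tendsto_of_tendsto_of_tendsto_of_le_of_le' tendsto_const_nhds hlim
    (Eventually.of_forall fun _ => zero_le)
    ((eventually_ge_atTop 3).mono fun n hn => (coeff_bounds ω d hn).2)

theorem isTheta_coeff {ω : ℝ≥0} (hω : 0 < ω) {d : ℝ≥0∞} (hd : d ≠ ∞) :
    (fun n : ℕ => (coeff ω d n).toReal) =Θ[atTop] (fun n : ℕ => (n : ℝ)⁻¹) := by
  set C : ℝ≥0∞ := ω + ω * 2 * d + (ω : ℝ≥0∞) ^ 2 * d with hC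
  have hCt : C ≠ ∞ := by finiteness
  have hfin : ∀ n : ℕ, 3 ≤ n → (n : ℝ≥0∞)⁻¹ * C ≠ ∞ := fun n hn =>
    ENNReal.mul_ne_top (ENNReal.inv_ne_top.2 (by exact_mod_cast (by omega : n ≠ 0))) hCt
  refine ⟨IsBigO.of_bound C.toReal ?_, IsBigO.of_bound (ω : ℝ)⁻¹ ?_⟩
  · filter_upwards [eventually_ge_atTop 3] with n hn
    have h := ENNReal.toReal_mono (hfin n hn) (coeff_bounds ω d hn).2
    rw [ENNReal.toReal_mul, ENNReal.toReal_inv, ENNReal.toReal_natCast] at h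
    rw [Real.norm_of_nonneg ENNReal.toReal_nonneg, Real.norm_of_nonneg (by positivity), mul_comm]
    exact h
  · filter_upwards [eventually_ge_atTop 3] with n hn
    have h := ENNReal.toReal_mono (ne_top_of_le_ne_top (hfin n hn) (coeff_bounds ω d hn).2)
      (coeff_bounds ω d hn).1
    rw [ENNReal.toReal_mul, ENNReal.toReal_inv, ENNReal.toReal_natCast,
      ENNReal.coe_toReal] at h
    rw [Real.norm_of_nonneg ENNReal.toReal_nonneg, Real.norm_of_nonneg (by positivity)]
    have hω' : (0 : ℝ) < ω := by exact_mod_cast hω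
    rw [le_inv_mul_iff₀ hω', mul_comm]
    exact h

end Asymptotic

/-- A bounded function of `T` whose integrals over the events `T ∈ D` are at most those of the
indicator of `s` is a lower bound for the conditional probability of `s` given `T`. -/
theorem ae_toReal_le_condExp_indicator {Ω β : Type*} [mΩ : MeasurableSpace Ω] [MeasurableSpace β]
    (P : Measure Ω) [IsProbabilityMeasure P] {T : Ω → β} (hT : Measurable T) {s : Set Ω}
    (hs : MeasurableSet s) {b : β → ℝ≥0∞} (hb : Measurable b) (hb1 : ∀ x, b x ≤ 1)
    (h : ∀ D, MeasurableSet D → ∫⁻ o in T ⁻¹' D, b (T o) ∂P ≤ P (s ∩ T ⁻¹' D)) :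
    ∀ᵐ o ∂P, (b (T o)).toReal ≤
      (P⟦s | MeasurableSpace.comap T inferInstance⟧) o := by
  set m : MeasurableSpace Ω := MeasurableSpace.comap T inferInstance with hm_def
  have hm : m ≤ mΩ := hT.comap_le
  have hgm : Measurable[m] fun o => (b (T o)).toReal :=
    hb.ennreal_toReal.comp (comap_measurable T)
  have hgs : StronglyMeasurable[m] fun o => (b (T o)).toReal := hgm.stronglyMeasurable
  have hgi : Integrable (fun o => (b (T o)).toReal) P := by
    refine Integrable.of_bound (hgs.mono hm).aestronglyMeasurable 1
      (Eventually.of_forall fun o => ?_)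
    rw [Real.norm_of_nonneg ENNReal.toReal_nonneg]
    exact ENNReal.toReal_le_of_le_ofReal zero_le_one (by simpa using hb1 (T o))
  have hsi : Integrable (s.indicator fun _ => (1 : ℝ)) P :=
    (integrable_const _).indicator hs
  refine ae_le_of_ae_le_trim (hm := hm) ?_
  refine ae_le_of_forall_setIntegral_le (hgi.trim hm hgs)
    (integrable_condExp.trim hm stronglyMeasurable_condExp) fun t ht _ => ?_
  rw [← setIntegral_trim hm hgs ht, ← setIntegral_trim hm stronglyMeasurable_condExp ht,
    setIntegral_condExp hm hsi ht]
  obtain ⟨D, hD, rfl⟩ := ht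
  rw [integral_toReal (f := fun o => b (T o)) (hb.comp hT).aemeasurable
    (Eventually.of_forall fun o => (hb1 _).trans_lt ENNReal.one_lt_top),
    setIntegral_indicator hs, setIntegral_const, smul_eq_mul, mul_one, measureReal_def,
    Set.inter_comm]
  exact ENNReal.toReal_mono (measure_ne_top _ _) (h D hD)

end ERS

end

/-! ### The matching bound -/

theorem proposition3 {Ω 𝒳 𝒴 𝒵 : Type*}
    [MeasurableSpace Ω] [MeasurableSpace 𝒳] [MeasurableSpace 𝒵]
    [MeasurableSpace 𝒴] [MeasurableEq 𝒴]
    (P : Measure Ω) [IsProbabilityMeasure P]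
    -- the batch size
    (N : ℕ) [NeZero N] (hN : 2 ≤ N)
    -- densities of the proposal `Q_Y`, the encoder's target `P_{Y|X}`, the decoder's `P̃_{Y|Z}`
    (ν : Measure 𝒴) (q : 𝒴 → ℝ≥0) (pA : 𝒳 → 𝒴 → ℝ≥0) (pB : 𝒵 → 𝒴 → ℝ≥0)
    (hq : ERS.IsDensity ν q) (hpA : ERS.IsCondDensity ν pA) (hpB : ERS.IsCondDensity ν pB)
    -- the ratio bounds `ω_x`, `ω_z` used by the two parties, and the common bound `ω`
    (ω : ℝ≥0) (ωA : 𝒳 → ℝ≥0) (ωB : 𝒵 → ℝ≥0) (hωA : Measurable ωA) (hωB : Measurable ωB)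
    (hA : ∀ x y, pA x y ≤ ωA x * q y) (hB : ∀ z y, pB z y ≤ ωB z * q y)
    (hAω : ∀ x, ωA x ≤ ω) (hBω : ∀ z, ωB z ≤ ω)
    -- the source `X`, the shared randomness `W` and the decoder's observation `Z`
    (X : Ω → 𝒳) (W : Ω → ERS.Randomness N 𝒴) (Z : Ω → 𝒵)
    (hX : Measurable X) (hW : Measurable W) (hZ : Measurable Z)
    (hWlaw : HasLaw W (ERS.randomnessLaw N (ERS.distOf ν q)) P)
    (hXW : IndepFun X W P)
    -- the outputs of the two parties
    (YA YB : Ω → 𝒴)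
    (hYA : ∀ o, YA o = ERS.output (pA (X o)) q (ωA (X o)) (W o))
    (hYB : ∀ o, YB o = ERS.output (pB (Z o)) q (ωB (Z o)) (W o))
    -- `Z ∼ P_{Z|X,Y}(·|x,y)` given `X = x`, `Y_A = y`, and `Z - (X, Y_A) - W` is a Markov chain
    (κ : Kernel (𝒳 × 𝒴) 𝒵) [IsMarkovKernel κ]
    (hMarkov : HasCondDistrib Z (fun o => ((X o, YA o), W o))
      (κ.prodMkRight (ERS.Randomness N 𝒴)) P) :
    -- the bound on `Pr(Y_A = Y_B | Y_A, X, Z)`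
    (∀ᵐ o ∂P,
      (ERS.matchBound (pA (X o)) (pB (Z o))
          (ERS.coeff ω (ERS.d2 ν q (pB (Z o))) N)
          (ERS.coeff ω (ERS.d2 ν q (pA (X o))) N) (YA o)).toReal
        ≤ (P⟦{o' | YA o' = YB o'} |
            MeasurableSpace.comap (fun o' => (YA o', X o', Z o')) inferInstance⟧) o) ∧
    -- the decay of the two coefficients at rate `1/N`
    (∀ z, ERS.d2 ν q (pB z) ≠ ∞ →
      Tendsto (fun n : ℕ => ERS.coeff ω (ERS.d2 ν q (pB z)) n) atTop (𝓝 0) ∧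
      (fun n : ℕ => (ERS.coeff ω (ERS.d2 ν q (pB z)) n).toReal)
        =Θ[atTop] (fun n : ℕ => (n : ℝ)⁻¹)) ∧
    (∀ x, ERS.d2 ν q (pA x) ≠ ∞ →
      Tendsto (fun n : ℕ => ERS.coeff ω (ERS.d2 ν q (pA x)) n) atTop (𝓝 0) ∧
      (fun n : ℕ => (ERS.coeff ω (ERS.d2 ν q (pA x)) n).toReal)
        =Θ[atTop] (fun n : ℕ => (n : ℝ)⁻¹)) := by
  obtain ⟨n, rfl⟩ : ∃ n, N = n + 1 := ⟨N - 1, by omega⟩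
  have hn : 1 ≤ n := by omega
  have hpos : ∀ {p : 𝒴 → ℝ≥0} {c : ℝ≥0}, ERS.IsDensity ν p → (∀ y, p y ≤ c * q y) → c ≤ ω →
      0 < ω := by
    intro p c hp h hc
    rw [pos_iff_ne_zero]
    rintro rfl
    have h0 : ∀ y, p y = 0 := fun y =>
      le_antisymm (by simpa [nonpos_iff_eq_zero.1 hc] using h y) zero_le
    have := hp.lintegral_eq_one
    simp [h0] at this
  refine ⟨?_, fun z hz => ⟨ERS.tendsto_coeff ω hz, ERS.isTheta_coeff
    (hpos (hpB.isDensity z) (hB z) (hBω z)) hz⟩, fun x hx => ⟨ERS.tendsto_coeff ω hx,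
    ERS.isTheta_coeff (hpos (hpA.isDensity x) (hA x) (hAω x)) hx⟩⟩
  have hYAm : Measurable YA := by
    rw [funext hYA]
    exact ERS.measurable_output hpA.measurable hq.measurable hωA hX hW
  have hYBm : Measurable YB := by
    rw [funext hYB]
    exact ERS.measurable_output hpB.measurable hq.measurable hωB hZ hW
  have hT : Measurable fun o => (YA o, X o, Z o) := hYAm.prodMk (hX.prodMk hZ)
  set b : 𝒴 × 𝒳 × 𝒵 → ℝ≥0∞ := fun t => ERS.matchBound (pA t.2.1) (pB t.2.2)
    (ERS.coeff ω (ERS.d2 ν q (pB t.2.2)) (n + 1)) (ERS.coeff ω (ERS.d2 ν q (pA t.2.1)) (n + 1)) t.1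
    with hb
  have hbm : Measurable b := ERS.measurable_matchBound hq hpA hpB ω (n + 1)
    measurable_snd.fst measurable_fst measurable_snd.snd
  have hmatch : MeasurableSet {o | YA o = YB o} := measurableSet_eq_fun hYAm hYBm
  refine ERS.ae_toReal_le_condExp_indicator P hT hmatch hbm
    (fun t => ERS.matchBound_le_one _ _ _ _ _) fun D hD => ?_
  have := hq.isProbabilityMeasure
  set ρ := ERS.randomnessLaw (n + 1) (ERS.distOf ν q) with hρ
  have : IsProbabilityMeasure ρ := by
    rw [hρ, ERS.randomnessLaw]
    infer_instance
  -- the joint law of source, shared randomness and decoder observation, disintegrated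
  have hdis : ∀ f : ((𝒳 × 𝒴) × ERS.Randomness (n + 1) 𝒴) × 𝒵 → ℝ≥0∞, Measurable f →
      ∫⁻ o, f (((X o, YA o), W o), Z o) ∂P =
        ∫⁻ x, ∫⁻ w, ∫⁻ z, f (((x, ERS.output (pA x) q (ωA x) w), w), z)
          ∂(κ (x, ERS.output (pA x) q (ωA x) w)) ∂ρ ∂(P.map X) := by
    intro f hf
    have hV : Measurable fun o => ((X o, YA o), W o) := (hX.prodMk hYAm).prodMk hW
    have hg : Measurable fun v : (𝒳 × 𝒴) × ERS.Randomness (n + 1) 𝒴 =>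
        ∫⁻ z, f (v, z) ∂(κ v.1) := by
      have := hf.lintegral_kernel_prod_right'
        (κ := κ.prodMkRight (ERS.Randomness (n + 1) 𝒴))
      simpa only [Kernel.prodMkRight_apply] using this
    have hXWlaw : P.map (fun o => (X o, W o)) = (P.map X).prod ρ := by
      rw [(indepFun_iff_map_prod_eq_prod_map_map hX.aemeasurable hW.aemeasurable).1 hXW,
        hWlaw.map_eq]
    have hU : Measurable fun v : 𝒳 × ERS.Randomness (n + 1) 𝒴 =>
        ((v.1, ERS.output (pA v.1) q (ωA v.1) v.2), v.2) :=
      (measurable_fst.prodMk (ERS.measurable_output hpA.measurable hq.measurable hωA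
        measurable_fst measurable_snd)).prodMk measurable_snd
    calc ∫⁻ o, f (((X o, YA o), W o), Z o) ∂P
        = ∫⁻ v, f v ∂(P.map fun o => (((X o, YA o), W o), Z o)) :=
          (lintegral_map hf (hV.prodMk hZ)).symm
      _ = ∫⁻ v, ∫⁻ z, f (v, z) ∂(κ v.1) ∂(P.map fun o => ((X o, YA o), W o)) := by
          rw [hMarkov.map_eq, Measure.lintegral_compProd hf]
          rfl
      _ = ∫⁻ o, ∫⁻ z, f (((X o, ERS.output (pA (X o)) q (ωA (X o)) (W o)), W o), z)
            ∂(κ (X o, ERS.output (pA (X o)) q (ωA (X o)) (W o))) ∂P := by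
          rw [lintegral_map hg hV]
          simp only [hYA]
      _ = ∫⁻ v, ∫⁻ z, f (((v.1, ERS.output (pA v.1) q (ωA v.1) v.2), v.2), z)
            ∂(κ (v.1, ERS.output (pA v.1) q (ωA v.1) v.2)) ∂(P.map fun o => (X o, W o)) :=
          (lintegral_map (hg.comp hU) (hX.prodMk hW)).symm
      _ = _ := by
          rw [hXWlaw]
          exact lintegral_prod _ (hg.comp hU).aemeasurable
  have hDb : Measurable (D.indicator b) := hbm.indicator hD
  have hproj : Measurable fun v : ((𝒳 × 𝒴) × ERS.Randomness (n + 1) 𝒴) × 𝒵 =>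
      (v.1.1.2, v.1.1.1, v.2) :=
    measurable_fst.fst.snd.prodMk (measurable_fst.fst.fst.prodMk measurable_snd)
  set M : Set (((𝒳 × 𝒴) × ERS.Randomness (n + 1) 𝒴) × 𝒵) :=
    {v | (v.1.1.2, v.1.1.1, v.2) ∈ D ∧ v.1.1.2 = ERS.output (pB v.2) q (ωB v.2) v.1.2} with hM
  have hMm : MeasurableSet M := (hproj hD).inter (measurableSet_eq_fun measurable_fst.fst.snd
    (ERS.measurable_output hpB.measurable hq.measurable hωB measurable_snd measurable_fst.snd))
  have hTD : MeasurableSet ((fun o => (YA o, X o, Z o)) ⁻¹' D) := hT hD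
  calc ∫⁻ o in (fun o => (YA o, X o, Z o)) ⁻¹' D, b (YA o, X o, Z o) ∂P
      = ∫⁻ o, D.indicator b (YA o, X o, Z o) ∂P := by
        rw [← lintegral_indicator hTD]
        rfl
    _ = ∫⁻ x, ∫⁻ w, ∫⁻ z, D.indicator b (ERS.output (pA x) q (ωA x) w, x, z)
          ∂(κ (x, ERS.output (pA x) q (ωA x) w)) ∂ρ ∂(P.map X) :=
        hdis (fun v => D.indicator b (v.1.1.2, v.1.1.1, v.2)) (hDb.comp hproj)
    _ ≤ ∫⁻ x, ∫⁻ w, ∫⁻ z, M.indicator 1 (((x, ERS.output (pA x) q (ωA x) w), w), z)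
          ∂(κ (x, ERS.output (pA x) q (ωA x) w)) ∂ρ ∂(P.map X) := by
        refine lintegral_mono fun x => ?_
        have hx : Measurable fun v : 𝒴 × 𝒵 => (v.1, x, v.2) :=
          measurable_fst.prodMk (measurable_const.prodMk measurable_snd)
        exact ERS.lintegral_matchBound_le hq (hpA.isDensity x) hpB hωB (hA x) hB (hAω x) hBω hn
          (κ.comap (fun y => (x, y)) measurable_prodMk_left) (hx hD)
    _ = ∫⁻ o, M.indicator 1 (((X o, YA o), W o), Z o) ∂P :=
        (hdis _ (measurable_one.indicator hMm)).symm
    _ = P ({o | YA o = YB o} ∩ (fun o => (YA o, X o, Z o)) ⁻¹' D) := by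
        rw [← lintegral_indicator_one (hmatch.inter hTD)]
        refine lintegral_congr fun o => ?_
        classical
        simp only [hM, Set.indicator_apply, Set.mem_inter_iff, Set.mem_ofPred_eq,
          Set.mem_preimage, hYB, Pi.one_apply, and_comm]
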